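/- Let $d\ge 1$, let $0\ne v\in\mathbb R^d$, let $\sigma_v(x)=x-2\frac{\langle v,x\rangle}{\|v\|^2}v$ be the orthogonal reflection in the hyperplane $\langle v\rangle^\perp$, let $\Omega\subset\mathbb R^d$ be a nonempty open set with $\sigma_v(\Omega)=\Omega$, and let $\Omega_+=\{x\in\Omega:\langle x,v\rangle>0\}$. Let $W=(W_t)_{t\ge0}$ be a $d$-dimensional Wiener process (Brownian motion) on a probability space: it starts from $x$ under $\mathbb P^x$ (that is, under $\mathbb P^x$ it is distributed as $x+B$ for a standard Wiener process $B$ starting from $0$), it has continuous paths almost surely and independent increments, and for $s<t$ the increment $W_t-W_s$ has the density $(2\pi(t-s))^{-d/2}\exp\bigl(-\|z\|^2/(2(t-s))\bigr)$. For an open set $D\subset\mathbb R^d$ let $\tau_D=\inf\{t\ge 0: W_t\notin D\}$ be the first exit time from $D$. A transition density of $W$ killed on exiting $D$ is a function $g^D_t(x,y)$, $t>0$, $x,y\in D$, such that for all $t>0$ and $x\in D$ the function $g_t^D(x,\cdot)$ is integrable on $D$ and $$\mathbb P^x\bigl(t<\tau_D,\ W_t\in A\bigr)=\int_A g^D_t(x,y)\,dy\qquad\text{for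 all Borel sets }A\subset D .$$ Then for $D=\Omega$ and for $D=\Omega_+$ there is a transition density of the process killed on exiting $D$ that is continuous in $y\in D$ for all $t>0$ and $x\in D$ (hence exactly one), and for these densities $$g_t^{\Omega_+}(x,y)=g_t^{\Omega}(x,y)-g_t^{\Omega}(\sigma_v(x),y)\qquad\text{for all } t>0,\ x,y\in\Omega_+ .$$ Moreover, for arbitrary transition densities $g^{\Omega}$ and $g^{\Omega_+}$, not necessarily continuous in $y$, the same identity holds for all $t>0$, all $x\in\Omega_+$ and almost every $y\in\Omega_+$. -/

import Mathlib

open MeasureTheory ProbabilityTheory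
open scoped NNReal

noncomputable section

/-- The Gaussian kernel `(2πt)^{-d/2} exp(-‖x - y‖² / (2t))` on `ℝ^d` (for `t > 0`). -/
def gaussianKernel {d : ℕ} (t : ℝ) (x y : EuclideanSpace ℝ (Fin d)) : ℝ :=
  (2 * Real.pi * t) ^ (-(d : ℝ) / 2) * Real.exp (-‖x - y‖ ^ 2 / (2 * t))

/-- `W` is a standard `d`-dimensional Wiener process under `P`: it starts at `0`, has independent
increments, `W t - W s` has the centred Gaussian law with covariance `(t - s) I`, and almost all
paths are continuous. The Wiener process starting at `x` is `t ↦ x + W t`. -/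
structure IsWienerProcess {d : ℕ} {S : Type*} [MeasurableSpace S]
    (W : ℝ≥0 → S → EuclideanSpace ℝ (Fin d)) (P : Measure S) : Prop where
  start : ∀ᵐ ω ∂P, W 0 ω = 0
  indep : HasIndepIncrements W P
  law : ∀ s t : ℝ≥0, s < t → HasLaw (W t - W s)
    (volume.withDensity fun z => ENNReal.ofReal (gaussianKernel ((t : ℝ) - s) 0 z)) P
  cont : ∀ᵐ ω ∂P, Continuous fun t => W t ω

/-- The first exit time `inf {t ≥ 0 : x + W t ∉ D}` (`⊤` if there is no such `t`) of the Wiener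
process starting at `x`. -/
def exitTime {d : ℕ} {S : Type*} (W : ℝ≥0 → S → EuclideanSpace ℝ (Fin d))
    (D : Set (EuclideanSpace ℝ (Fin d))) (x : EuclideanSpace ℝ (Fin d)) : S → WithTop ℝ≥0 :=
  hittingAfter (fun t ω => x + W t ω) Dᶜ 0

/-- `g` is a transition density of the Wiener process killed on exiting `D`: for all `t > 0` and
`x ∈ D`, the function `g t x` is a density on `D` of `A ↦ P(t < τ_D, x + W t ∈ A)`. -/
structure IsKilledTransitionDensity {d : ℕ} {S : Type*} [MeasurableSpace S]
    (W : ℝ≥0 → S → EuclideanSpace ℝ (Fin d)) (P : Measure S)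
    (D : Set (EuclideanSpace ℝ (Fin d)))
    (g : ℝ≥0 → EuclideanSpace ℝ (Fin d) → EuclideanSpace ℝ (Fin d) → ℝ) : Prop where
  integrable : ∀ t : ℝ≥0, 0 < t → ∀ x ∈ D, IntegrableOn (g t x) D volume
  density : ∀ t : ℝ≥0, 0 < t → ∀ x ∈ D, ∀ A : Set (EuclideanSpace ℝ (Fin d)),
    MeasurableSet A → A ⊆ D →
      P.real {ω | (t : WithTop ℝ≥0) < exitTime W D x ω ∧ x + W t ω ∈ A} = ∫ y in A, g t x y

/-- A transition density of the killed process that is continuous in its last variable. For open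
`D` this determines `g t x y` for all `t > 0` and `x, y ∈ D`. -/
structure IsContinuousKilledTransitionDensity {d : ℕ} {S : Type*} [MeasurableSpace S]
    (W : ℝ≥0 → S → EuclideanSpace ℝ (Fin d)) (P : Measure S)
    (D : Set (EuclideanSpace ℝ (Fin d)))
    (g : ℝ≥0 → EuclideanSpace ℝ (Fin d) → EuclideanSpace ℝ (Fin d) → ℝ) : Prop
    extends IsKilledTransitionDensity W P D g where
  continuousOn : ∀ t : ℝ≥0, 0 < t → ∀ x ∈ D, ContinuousOn (g t x) D

/-- The orthogonal reflection `σ_v` in the hyperplane perpendicular to `v`. -/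
def hyperplaneReflection {d : ℕ} (v x : EuclideanSpace ℝ (Fin d)) : EuclideanSpace ℝ (Fin d) :=
  x - (2 * (inner ℝ v x / ‖v‖ ^ 2)) • v

/-- The positive part of `Ω` with respect to `v`. -/
def positivePart {d : ℕ} (v : EuclideanSpace ℝ (Fin d)) (Ω : Set (EuclideanSpace ℝ (Fin d))) :
    Set (EuclideanSpace ℝ (Fin d)) :=
  {x ∈ Ω | 0 < inner ℝ x v}

end

/-! The identity is the reflection principle. Start at `x` on the positive side and reflect the path
from its first hit of the hyperplane onwards. By the strong Markov property and the reflection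
invariance of Brownian increments the law is unchanged, and by the symmetry of `Ω` survival in `Ω`
is unchanged too. A path that survives in `Ω` and ends in `A ⊆ Ω_+` either never meets the
hyperplane, so that it survives in `Ω_+`, or meets it and corresponds to a surviving path that ends
in `σ_v(A)`. A path from `x` that ends in `σ_v(A)` must cross, so the second term is the full killed
mass of `σ_v(A)` from `x`, which by symmetry is the killed mass of `A` from `σ_v(x)`. This is
`measure_stay_eq_add` combined with `measure_stay_isometry`; comparing integrals over all `A` gives
the identity almost everywhere, and continuity gives it everywhere.

Existence of continuous densities is Hunt's formula: the killed density is the Gaussian kernel minus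
the expected Gaussian kernel restarted at the exit point with the remaining time (`measure_exit`).
The exit point lies outside `D`, and the kernel is bounded off the diagonal uniformly in time, so
dominated convergence makes the correction finite and continuous on `D`.

Both arguments use one form of the strong Markov property, `map_splice_eq`: after a stopping time
the path may continue with other increments, namely reflected ones or those of an independent copy.
Its fixed-time hypothesis comes from independence of past and future increments. -/

open Filter Topology

set_option linter.unusedSectionVars false

noncomputable section

/-! ### Stopping, splicing and exit times of deterministic paths -/

section Paths

variable {E : Type*}

/-- The path `w` stopped at time `s`. -/
def stopPath (s : ℝ≥0) (w : ℝ≥0 → E) : ℝ≥0 → E := fun t => w (min t s)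

/-- The path that follows `w` until time `T` and moves with the increments of `z` afterwards. -/
def splice [AddCommGroup E] (T : ℝ≥0) (w z : ℝ≥0 → E) : ℝ≥0 → E :=
  fun t => w (min t T) + (z t - z (min t T))

/-- The first time at which the path `w` is outside `D`, capped at `t`. -/
def exitBefore (D : Set E) (t : ℝ≥0) (w : ℝ≥0 → E) : ℝ≥0 :=
  sInf ({s | w s ∉ D} ∪ {t})

lemma exitBefore_le (D : Set E) (t : ℝ≥0) (w : ℝ≥0 → E) : exitBefore D t w ≤ t :=
  csInf_le (OrderBot.bddBelow _) (by simp)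

lemma exitBefore_le_of_notMem {D : Set E} {t s : ℝ≥0} {w : ℝ≥0 → E} (h : w s ∉ D) :
    exitBefore D t w ≤ s :=
  csInf_le (OrderBot.bddBelow _) (Set.mem_union_left _ h)

lemma exitBefore_eq_of_forall_mem {D : Set E} {t : ℝ≥0} {w : ℝ≥0 → E}
    (h : ∀ s ≤ t, w s ∈ D) : exitBefore D t w = t := by
  refine le_antisymm (exitBefore_le D t w) (le_csInf ⟨t, by simp⟩ ?_)
  rintro s (hs | rfl)
  · by_contra hst
    exact hs (h s (not_le.1 hst).le)
  · exact le_rfl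

lemma splice_of_le [AddCommGroup E] {T t : ℝ≥0} (w z : ℝ≥0 → E) (h : t ≤ T) :
    splice T w z t = w t := by
  simp [splice, min_eq_left h]

lemma splice_of_ge [AddCommGroup E] {T t : ℝ≥0} (w z : ℝ≥0 → E) (h : T ≤ t) :
    splice T w z t = w T + (z t - z T) := by
  simp [splice, min_eq_right h]

lemma continuous_splice [AddCommGroup E] [TopologicalSpace E] [IsTopologicalAddGroup E] (T : ℝ≥0)
    {w z : ℝ≥0 → E} (hw : Continuous w) (hz : Continuous z) : Continuous (splice T w z) := by
  unfold splice
  fun_prop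

variable [TopologicalSpace E]

lemma isClosed_exitTimes {D : Set E} (hD : IsOpen D) {w : ℝ≥0 → E} (hw : Continuous w) (t : ℝ≥0) :
    IsClosed ({s | w s ∉ D} ∪ {t}) :=
  (hD.isClosed_compl.preimage hw).union isClosed_singleton

/-- A continuous path that leaves an open set by time `t` is outside it at the exit time. -/
lemma apply_exitBefore_notMem {D : Set E} (hD : IsOpen D) {w : ℝ≥0 → E} (hw : Continuous w)
    {t : ℝ≥0} (h : ¬ ∀ s ≤ t, w s ∈ D) : w (exitBefore D t w) ∉ D := by
  push Not at h
  obtain ⟨s, hst, hs⟩ := h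
  have hmem : exitBefore D t w ∈ {s | w s ∉ D} ∪ {t} :=
    (isClosed_exitTimes hD hw t).csInf_mem ⟨t, by simp⟩ (OrderBot.bddBelow _)
  rcases hmem with h | h
  · exact h
  · have h1 : exitBefore D t w ≤ s := exitBefore_le_of_notMem hs
    have h2 : exitBefore D t w = t := h
    have h3 : s = t := le_antisymm hst (h2 ▸ h1)
    rw [h2, ← h3]
    exact hs

/-- The set of exit times together with the cap is closed and nonempty, so its infimum is attained.
The right side depends only on the path up to `s`, which is what makes the exit time a stopping
time. -/
lemma exitBefore_le_iff {D : Set E} (hD : IsOpen D) {w : ℝ≥0 → E} (hw : Continuous w)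
    {t s : ℝ≥0} : exitBefore D t w ≤ s ↔ t ≤ s ∨ ¬ ∀ r ≤ s, w r ∈ D := by
  constructor
  · intro h
    have hmem : exitBefore D t w ∈ {s | w s ∉ D} ∪ {t} :=
      (isClosed_exitTimes hD hw t).csInf_mem ⟨t, by simp⟩ (OrderBot.bddBelow _)
    rcases hmem with h' | h'
    · exact Or.inr fun hall => h' (hall _ h)
    · exact Or.inl ((show exitBefore D t w = t from h') ▸ h)
  · rintro (h | h)
    · exact (exitBefore_le D t w).trans h
    · push Not at h
      obtain ⟨r, hr, hrD⟩ := h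
      exact (exitBefore_le_of_notMem hrD).trans hr

/-- Splicing at the exit time from an open set does not change whether that set is left. -/
lemma forall_splice_exitBefore_mem_iff [AddCommGroup E] {D : Set E}
    (hD : IsOpen D) {w z : ℝ≥0 → E} (hw : Continuous w) {t : ℝ≥0} :
    (∀ s ≤ t, splice (exitBefore D t w) w z s ∈ D) ↔ ∀ s ≤ t, w s ∈ D := by
  constructor
  · intro h
    by_contra hn
    have := h _ (exitBefore_le D t w)
    rw [splice_of_le _ _ le_rfl] at this
    exact apply_exitBefore_notMem hD hw hn this
  · intro h s hs
    rw [exitBefore_eq_of_forall_mem h, splice_of_le _ _ hs]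
    exact h s hs

end Paths

/-! ### Survival as a measurable event on path space -/

section Measurability

variable {E : Type*} [PseudoEMetricSpace E]

/-- A set of paths, described at countably many times, whose continuous members are the
continuous paths that remain in `D` up to time `t`, for `D` open. -/
def staySet (D : Set E) (t : ℝ≥0) : Set (ℝ≥0 → E) :=
  {w | ∃ n : ℕ, ∀ k : ℕ,
    ((n : ENNReal) + 1)⁻¹ ≤ Metric.infEDist (w (min (TopologicalSpace.denseSeq ℝ≥0 k) t)) Dᶜ}

lemma measurableSet_staySet [MeasurableSpace E] [OpensMeasurableSpace E] (D : Set E) (t : ℝ≥0) :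
    MeasurableSet (staySet D t) := by
  unfold staySet
  rw [Set.ofPred_exists]
  refine MeasurableSet.iUnion fun n => ?_
  rw [Set.ofPred_forall]
  refine MeasurableSet.iInter fun k => ?_
  exact measurableSet_le measurable_const (measurable_infEDist.comp (measurable_pi_apply _))

/-- A compact piece of path inside an open set keeps a positive distance from the complement, and by
continuity such a lower bound need only be tested at a dense set of times. -/
lemma mem_staySet_iff {D : Set E} (hD : IsOpen D) {w : ℝ≥0 → E} (hw : Continuous w) (t : ℝ≥0) :
    w ∈ staySet D t ↔ ∀ s ≤ t, w s ∈ D := by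
  have hcont : Continuous fun q => Metric.infEDist (w (min q t)) Dᶜ :=
    Metric.continuous_infEDist.comp (hw.comp (by fun_prop))
  constructor
  · rintro ⟨n, hn⟩ s hs
    have hall : ∀ q, ((n : ENNReal) + 1)⁻¹ ≤ Metric.infEDist (w (min q t)) Dᶜ := by
      intro q
      exact (isClosed_le continuous_const hcont).closure_subset_iff.2
        (by rintro _ ⟨k, rfl⟩; exact hn k) ((TopologicalSpace.denseRange_denseSeq ℝ≥0) q)
    have h := hall s
    rw [min_eq_left hs] at h
    by_contra hsD
    have h0 : Metric.infEDist (w s) Dᶜ = 0 := Metric.infEDist_zero_of_mem hsD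
    rw [h0] at h
    simp at h
  · intro h
    obtain ⟨q, -, hq⟩ := (isCompact_Icc (a := (0 : ℝ≥0)) (b := t)).exists_isMinOn
      ⟨0, by simp⟩ hcont.continuousOn
    have hpos : Metric.infEDist (w (min q t)) Dᶜ ≠ 0 := by
      intro h0
      have := (Metric.mem_iff_infEDist_zero_of_closed hD.isClosed_compl).2 h0
      exact this (h _ (min_le_right _ _))
    obtain ⟨n, hn⟩ := ENNReal.exists_inv_nat_lt hpos
    refine ⟨n, fun k => ?_⟩
    have hle : ((n : ENNReal) + 1)⁻¹ ≤ (n : ENNReal)⁻¹ :=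
      ENNReal.inv_le_inv.2 le_self_add
    refine hle.trans (hn.le.trans ?_)
    have := hq (a := min (TopologicalSpace.denseSeq ℝ≥0 k) t) (by simp)
    simpa using this

lemma stopPath_mem_staySet_iff (D : Set E) (t : ℝ≥0) (w : ℝ≥0 → E) :
    stopPath t w ∈ staySet D t ↔ w ∈ staySet D t := by
  simp [staySet, stopPath]

end Measurability

lemma measurable_stopPath {E : Type*} [MeasurableSpace E] (s : ℝ≥0) :
    Measurable (stopPath s : (ℝ≥0 → E) → ℝ≥0 → E) :=
  measurable_pi_lambda _ fun _ => measurable_pi_apply _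

/-! ### The strong Markov property in terms of spliced paths -/

section StrongMarkov

variable {S E : Type*} [MeasurableSpace S] {P : Measure S}

lemma measure_eq_tsum_inter_preimage_singleton {N : S → ℕ} (hN : ∀ k, MeasurableSet (N ⁻¹' {k}))
    {A : Set S} (hA : MeasurableSet A) : P A = ∑' k, P (A ∩ N ⁻¹' {k}) := by
  rw [← measure_iUnion]
  · congr 1
    ext ω
    simp
  · intro i j hij
    refine Set.disjoint_left.2 fun ω h1 h2 => hij ?_
    exact h1.2.symm.trans h2.2
  · exact fun k => hA.inter (hN k)

variable [NormedAddCommGroup E] [MeasurableSpace E] [BorelSpace E] [SecondCountableTopology E]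

/-- Splicing at a random time with countably many values, each of which is detected by the stopped
path, preserves the law of the process. -/
lemma map_splice_eq_of_countable {V X : ℝ≥0 → S → E} (hV : ∀ t, Measurable (V t))
    (hX : ∀ t, Measurable (X t))
    (hlaw : ∀ s, P.map (fun ω => (stopPath s (V · ω), fun t => X t ω - X (min t s) ω)) =
      P.map (fun ω => (stopPath s (V · ω), fun t => V t ω - V (min t s) ω)))
    {N : S → ℕ} {f : ℕ → ℝ≥0} {B : ℕ → Set (ℝ≥0 → E)} (hB : ∀ k, MeasurableSet (B k))
    (hN : ∀ k ω, N ω = k ↔ stopPath (f k) (V · ω) ∈ B k) :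
    Measurable (fun ω => splice (f (N ω)) (V · ω) (X · ω)) ∧
    P.map (fun ω => splice (f (N ω)) (V · ω) (X · ω)) = P.map (fun ω => (V · ω)) := by
  have hVp : Measurable fun ω => (V · ω) := measurable_pi_lambda _ hV
  have hXp : Measurable fun ω => (X · ω) := measurable_pi_lambda _ hX
  have hVstop : ∀ s, Measurable fun ω => stopPath s (V · ω) := fun s =>
    (measurable_stopPath s).comp hVp
  have hNm : ∀ k, MeasurableSet (N ⁻¹' {k}) := fun k => by
    have : N ⁻¹' {k} = (fun ω => stopPath (f k) (V · ω)) ⁻¹' B k := by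
      ext ω; exact hN k ω
    rw [this]
    exact hVstop _ (hB k)
  have hNmeas : Measurable N := measurable_to_countable' hNm
  have hsm : Measurable (fun ω => splice (f (N ω)) (V · ω) (X · ω)) := by
    have hfix : ∀ s, Measurable fun ω => splice s (V · ω) (X · ω) := fun s =>
      measurable_pi_lambda _ fun t => (hV _).add ((hX _).sub (hX _))
    have h2 : Measurable (Function.uncurry fun (k : ℕ) ω => splice (f k) (V · ω) (X · ω)) :=
      measurable_from_prod_countable_right fun k => hfix (f k)
    exact h2.comp (hNmeas.prodMk measurable_id)
  refine ⟨hsm, Measure.ext fun C hC => ?_⟩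
  rw [Measure.map_apply hsm hC, Measure.map_apply hVp hC,
    measure_eq_tsum_inter_preimage_singleton hNm (hsm hC),
    measure_eq_tsum_inter_preimage_singleton hNm (hVp hC)]
  refine tsum_congr fun k => ?_
  -- On `N = k` the spliced path is the stopped path plus later increments, and the event `N = k` is
  -- read off the stopped path. So both sides are the mass of this one set under the two laws in
  -- `hlaw`.
  let G : Set ((ℝ≥0 → E) × (ℝ≥0 → E)) := {p | p.1 + p.2 ∈ C} ∩ (Prod.fst ⁻¹' B k)
  have hG : MeasurableSet G := by
    refine MeasurableSet.inter ?_ (measurable_fst (hB k))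
    exact (measurable_pi_lambda _ fun t => ((measurable_pi_apply t).comp measurable_fst).add
      ((measurable_pi_apply t).comp measurable_snd) :
      Measurable fun p : (ℝ≥0 → E) × (ℝ≥0 → E) => p.1 + p.2) hC
  have hm : ∀ Z : ℝ≥0 → S → E, (∀ t, Measurable (Z t)) → Measurable
      (fun ω => (stopPath (f k) (V · ω), fun t => Z t ω - Z (min t (f k)) ω)) := fun Z hZ =>
    (hVstop _).prodMk (measurable_pi_lambda _ fun t => (hZ _).sub (hZ _))
  have h1 := congrArg (fun μ => μ G) (hlaw (f k))
  simp only [Measure.map_apply (hm X hX) hG, Measure.map_apply (hm V hV) hG] at h1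
  convert h1 using 2
  · ext ω
    simp only [Set.mem_inter_iff, Set.mem_preimage, Set.mem_singleton_iff, G, Set.mem_ofPred_eq,
      ← hN k ω]
    refine and_congr_left fun hk => ?_
    rw [hk]
    rfl
  · ext ω
    simp only [Set.mem_inter_iff, Set.mem_preimage, Set.mem_singleton_iff, G, Set.mem_ofPred_eq,
      ← hN k ω]
    refine and_congr_left fun hk => ?_
    have : (stopPath (f k) (V · ω) + fun t => V t ω - V (min t (f k)) ω) = (V · ω) := by
      ext t; simp [stopPath]
    rw [this]

/-- If processes `U n` with the law of `V` converge pointwise to `U`, then `U` has the law of `V`. -/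
lemma map_process_eq_of_tendsto [IsProbabilityMeasure P] {V U : ℝ≥0 → S → E}
    {Un : ℕ → ℝ≥0 → S → E} (hV : ∀ t, Measurable (V t)) (hUn : ∀ n t, Measurable (Un n t))
    (hlaw : ∀ n, P.map (fun ω => (Un n · ω)) = P.map (fun ω => (V · ω)))
    (hlim : ∀ t ω, Tendsto (fun n => Un n t ω) atTop (𝓝 (U t ω))) :
    P.map (fun ω => (U · ω)) = P.map (fun ω => (V · ω)) := by
  have hU : ∀ t, Measurable (U t) := fun t =>
    measurable_of_tendsto_metrizable (fun n => hUn n t) (tendsto_pi_nhds.2 (hlim t))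
  have hVp : Measurable fun ω => (V · ω) := measurable_pi_lambda _ hV
  have hUp : Measurable fun ω => (U · ω) := measurable_pi_lambda _ hU
  have hUnp : ∀ n, Measurable fun ω => (Un n · ω) := fun n => measurable_pi_lambda _ (hUn n)
  -- Finite-dimensional laws determine the law on path space, and pointwise limits pass through
  -- integrals of bounded continuous functions.
  rw [map_eq_iff_forall_finset_map_restrict_eq hUp.aemeasurable hVp.aemeasurable]
  intro I
  have hr : ∀ {Z : ℝ≥0 → S → E}, Measurable (fun ω => (Z · ω)) →
      Measurable fun ω => I.restrict (Z · ω) := fun hZ => (Finset.measurable_restrict I).comp hZ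
  have : IsProbabilityMeasure (P.map fun ω => I.restrict (U · ω)) :=
    Measure.isProbabilityMeasure_map (hr hUp).aemeasurable
  have : IsProbabilityMeasure (P.map fun ω => I.restrict (V · ω)) :=
    Measure.isProbabilityMeasure_map (hr hVp).aemeasurable
  refine ext_of_forall_integral_eq_of_IsFiniteMeasure fun F => ?_
  rw [integral_map (hr hUp).aemeasurable F.continuous.aestronglyMeasurable,
    integral_map (hr hVp).aemeasurable F.continuous.aestronglyMeasurable]
  have hconst : ∀ n, ∫ ω, F (I.restrict (Un n · ω)) ∂P = ∫ ω, F (I.restrict (V · ω)) ∂P := by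
    intro n
    have h := (map_eq_iff_forall_finset_map_restrict_eq (hUnp n).aemeasurable
      hVp.aemeasurable).1 (hlaw n) I
    rw [← integral_map (hr (hUnp n)).aemeasurable F.continuous.aestronglyMeasurable, h,
      integral_map (hr hVp).aemeasurable F.continuous.aestronglyMeasurable]
  have hlim' : Tendsto (fun n => ∫ ω, F (I.restrict (Un n · ω)) ∂P) atTop
      (𝓝 (∫ ω, F (I.restrict (U · ω)) ∂P)) := by
    refine tendsto_integral_of_dominated_convergence (fun _ => ‖F‖) (fun n => ?_)
      (integrable_const _) (fun n => ae_of_all _ fun ω => F.norm_coe_le_norm _)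
      (ae_of_all _ fun ω => ?_)
    · exact (F.continuous.measurable.comp (hr (hUnp n))).aestronglyMeasurable
    · exact (F.continuous.tendsto _).comp (tendsto_pi_nhds.2 fun i => hlim i ω)
  exact tendsto_nhds_unique hlim' (by simp only [hconst]; exact tendsto_const_nhds)

/-- A form of the strong Markov property: if at every fixed time the increments of `V` after that
time can be replaced with those of `X`, jointly with the past of `V`, without changing the law,
then the same holds at every stopping time of `V`. -/
theorem map_splice_eq [IsProbabilityMeasure P] {V X : ℝ≥0 → S → E} (hV : ∀ t, Measurable (V t))
    (hX : ∀ t, Measurable (X t)) (hVc : ∀ ω, Continuous (V · ω)) (hXc : ∀ ω, Continuous (X · ω))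
    (hlaw : ∀ s, P.map (fun ω => (stopPath s (V · ω), fun t => X t ω - X (min t s) ω)) =
      P.map (fun ω => (stopPath s (V · ω), fun t => V t ω - V (min t s) ω)))
    {T : S → ℝ≥0} (hT : ∀ s, ∃ B : Set (ℝ≥0 → E), MeasurableSet B ∧
      ∀ ω, T ω ≤ s ↔ stopPath s (V · ω) ∈ B) :
    P.map (fun ω => splice (T ω) (V · ω) (X · ω)) = P.map (fun ω => (V · ω)) := by
  choose B hBm hB using hT
  -- Round `T` up to the grid of mesh `1 / (n + 1)`. Rounding up, not down, keeps it a stopping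
  -- time: `N n ω ≤ k` exactly when `T ω ≤ f n k`.
  let N : ℕ → S → ℕ := fun n ω => ⌈T ω * (n + 1)⌉₊
  let f : ℕ → ℕ → ℝ≥0 := fun n k => k / (n + 1)
  -- The event `N = j + 1` says that `T` is at most `f n (j + 1)` but not at most `f n j`; both are
  -- visible on the path stopped at `f n (j + 1)`.
  let C : ℕ → ℕ → Set (ℝ≥0 → E) := fun n k => Nat.casesOn k (B 0)
    (fun j => B (f n (j + 1)) \ (stopPath (f n j)) ⁻¹' B (f n j))
  have hle : ∀ n k ω, N n ω ≤ k ↔ T ω ≤ f n k := by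
    intro n k ω
    simp only [N, f, Nat.ceil_le]
    rw [le_div_iff₀ (by positivity)]
  have hfmono : ∀ n j, f n j ≤ f n (j + 1) := by
    intro n j
    simp only [f]
    gcongr
    simp
  have hCm : ∀ n k, MeasurableSet (C n k) := by
    rintro n (_ | j)
    · exact hBm 0
    · exact (hBm _).diff (measurable_stopPath _ (hBm _))
  have hN : ∀ n k ω, N n ω = k ↔ stopPath (f n k) (V · ω) ∈ C n k := by
    rintro n (_ | j) ω
    · have h0 : f n 0 = 0 := by simp [f]
      rw [h0]
      change _ ↔ _ ∈ B 0
      rw [← hB, ← h0, ← hle]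
      omega
    · have hss : stopPath (f n j) (stopPath (f n (j + 1)) (V · ω)) = stopPath (f n j) (V · ω) := by
        ext t
        simp only [stopPath]
        rw [min_assoc, min_eq_left (hfmono n j)]
      change _ ↔ _ ∈ B (f n (j + 1)) \ (stopPath (f n j)) ⁻¹' B (f n j)
      rw [Set.mem_sdiff, Set.mem_preimage, hss, ← hB, ← hB, ← hle, ← hle]
      omega
  have key := fun n => map_splice_eq_of_countable hV hX hlaw (hCm n) (hN n)
  have hTn : ∀ ω, Tendsto (fun n => f n (N n ω)) atTop (𝓝 (T ω)) := by
    intro ω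
    have hbound : ∀ n, f n (N n ω) ≤ T ω + 1 / ((n : ℝ≥0) + 1) := by
      intro n
      simp only [f, N]
      rw [div_le_iff₀ (by positivity), add_mul, one_div, inv_mul_cancel₀ (by positivity)]
      exact (Nat.ceil_lt_add_one (zero_le)).le
    refine tendsto_of_tendsto_of_tendsto_of_le_of_le tendsto_const_nhds ?_
      (fun n => (hle n _ ω).1 le_rfl) hbound
    have : Tendsto (fun n : ℕ => 1 / ((n : ℝ≥0) + 1)) atTop (𝓝 0) :=
      tendsto_one_div_add_atTop_nhds_zero_nat
    simpa using this.const_add (T ω)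
  refine map_process_eq_of_tendsto (U := fun t ω => splice (T ω) (V · ω) (X · ω) t)
    (Un := fun n t ω => splice (f n (N n ω)) (V · ω) (X · ω) t) hV
    (fun n t => (measurable_pi_apply t).comp (key n).1) (fun n => (key n).2) (fun t ω => ?_)
  have hcont : Continuous fun T => splice T (V · ω) (X · ω) t := by
    have h1 := hVc ω
    have h2 := hXc ω
    unfold splice
    fun_prop
  exact (hcont.tendsto _).comp (hTn ω)

lemma measurable_of_le_iff_stopPath_mem {V : ℝ≥0 → S → E} (hV : ∀ t, Measurable (V t))
    {T : S → ℝ≥0} (hT : ∀ s, ∃ B : Set (ℝ≥0 → E), MeasurableSet B ∧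
      ∀ ω, T ω ≤ s ↔ stopPath s (V · ω) ∈ B) : Measurable T := by
  refine measurable_of_Iic fun s => ?_
  obtain ⟨B, hB, h⟩ := hT s
  have : T ⁻¹' Set.Iic s = (fun ω => stopPath s (V · ω)) ⁻¹' B := by
    ext ω; exact h ω
  rw [this]
  exact (measurable_stopPath s).comp (measurable_pi_lambda _ hV) hB

/-- The exit time of a continuous process from an open set is a stopping time. -/
lemma exitBefore_le_iff_stopPath_mem {V : ℝ≥0 → S → E} (hVc : ∀ ω, Continuous (V · ω))
    {D : Set E} (hD : IsOpen D) (t s : ℝ≥0) : ∃ B : Set (ℝ≥0 → E), MeasurableSet B ∧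
      ∀ ω, exitBefore D t (V · ω) ≤ s ↔ stopPath s (V · ω) ∈ B := by
  by_cases hts : t ≤ s
  · exact ⟨Set.univ, MeasurableSet.univ, fun ω => by
      simp [(exitBefore_le D t _).trans hts]⟩
  · refine ⟨(staySet D s)ᶜ, (measurableSet_staySet D s).compl, fun ω => ?_⟩
    rw [exitBefore_le_iff hD (hVc ω), Set.mem_compl_iff, stopPath_mem_staySet_iff,
      mem_staySet_iff hD (hVc ω)]
    simp [hts]

/-- Continuous processes with the same law have the same killed distributions. -/
lemma measure_stay_eq_of_map_eq {S' : Type*} [MeasurableSpace S'] {P' : Measure S'}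
    {V : ℝ≥0 → S → E} {U : ℝ≥0 → S' → E} (hV : ∀ t, Measurable (V t))
    (hU : ∀ t, Measurable (U t)) (hVc : ∀ ω, Continuous (V · ω)) (hUc : ∀ ω, Continuous (U · ω))
    (h : P.map (fun ω => (V · ω)) = P'.map (fun ω => (U · ω))) {D A : Set E} (hD : IsOpen D)
    (hA : MeasurableSet A) (t : ℝ≥0) :
    P {ω | (∀ s ≤ t, V s ω ∈ D) ∧ V t ω ∈ A} = P' {ω | (∀ s ≤ t, U s ω ∈ D) ∧ U t ω ∈ A} := by
  have hK : MeasurableSet (staySet D t ∩ (fun w : ℝ≥0 → E => w t) ⁻¹' A) :=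
    (measurableSet_staySet D t).inter (measurable_pi_apply t hA)
  have h1 := congrArg (fun μ => μ (staySet D t ∩ (fun w : ℝ≥0 → E => w t) ⁻¹' A)) h
  simp only [Measure.map_apply (measurable_pi_lambda _ hV : Measurable fun ω => (V · ω)) hK,
    Measure.map_apply (measurable_pi_lambda _ hU : Measurable fun ω => (U · ω)) hK] at h1
  convert h1 using 2
  · ext ω
    simp [← mem_staySet_iff hD (hVc ω)]
  · ext ω
    simp [← mem_staySet_iff hD (hUc ω)]

lemma measurableSet_stay {V : ℝ≥0 → S → E} (hV : ∀ t, Measurable (V t))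
    (hVc : ∀ ω, Continuous (V · ω)) {D : Set E} (hD : IsOpen D) (t : ℝ≥0) :
    MeasurableSet {ω | ∀ s ≤ t, V s ω ∈ D} := by
  convert (measurable_pi_lambda _ hV : Measurable fun ω => (V · ω)) (measurableSet_staySet D t)
    using 1
  ext ω
  simp [← mem_staySet_iff hD (hVc ω)]

end StrongMarkov

/-! ### Independent increments: past against future, and determination of the law -/

section Increments

/-- Independence of increments is used along monotone sequences indexed by `ℕ`; the sorted
enumeration of `K` with `0` added is continued constantly after its last term. -/
lemma exists_monotone_nat_enumeration (K : Finset ℝ≥0) :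
    ∃ t : ℕ → ℝ≥0, Monotone t ∧ t 0 = 0 ∧ ∀ x ∈ K, ∃ k, t k = x := by
  classical
  set K' := insert 0 K with hK'
  have hpos : 0 < K'.card := Finset.card_pos.2 ⟨0, by simp [hK']⟩
  have hsurj : ∀ x ∈ K', ∃ i : Fin K'.card, K'.orderEmbOfFin rfl i = x := by
    intro x hx
    have : x ∈ Set.range (K'.orderEmbOfFin rfl) := by simpa using hx
    exact this
  refine ⟨fun k => K'.orderEmbOfFin rfl ⟨min k (K'.card - 1), by omega⟩, fun a b hab => ?_, ?_,
    fun x hx => ?_⟩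
  · apply (K'.orderEmbOfFin rfl).monotone
    rw [Fin.mk_le_mk]
    omega
  · obtain ⟨i, hi⟩ := hsurj 0 (by simp [hK'])
    refine le_antisymm ?_ zero_le
    rw [← hi]
    apply (K'.orderEmbOfFin rfl).monotone
    rw [← Fin.eta i i.2, Fin.mk_le_mk]
    omega
  · obtain ⟨i, hi⟩ := hsurj x (by simp [hK', hx])
    refine ⟨i, ?_⟩
    rw [← hi]
    have := i.2
    exact congrArg _ (Fin.ext (min_eq_left (by omega)))

variable {S E : Type*} [MeasurableSpace S] {P : Measure S}
  [NormedAddCommGroup E] [MeasurableSpace E] [BorelSpace E] [SecondCountableTopology E]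

/-- The partial sum over `[a, b)` of a vector indexed by a finite set of natural numbers. -/
def sumIco (s : Finset ℕ) (a b : ℕ) (d : s → E) : E :=
  ∑ l : s, if (l : ℕ) ∈ Finset.Ico a b then d l else 0

lemma measurable_sumIco (s : Finset ℕ) (a b : ℕ) :
    Measurable (sumIco s a b : (s → E) → E) := by
  unfold sumIco
  refine Finset.measurable_sum _ fun l _ => ?_
  split_ifs
  · exact measurable_pi_apply l
  · exact measurable_const

lemma sumIco_increments (u : ℕ → E) {s : Finset ℕ} {a b : ℕ} (hab : a ≤ b)
    (hs : Finset.Ico a b ⊆ s) :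
    sumIco s a b (fun l => u (l + 1) - u l) = u b - u a := by
  unfold sumIco
  rw [Finset.sum_coe_sort s fun l => if l ∈ Finset.Ico a b then u (l + 1) - u l else 0,
    Finset.sum_ite_mem, Finset.inter_eq_right.2 hs, Finset.sum_Ico_sub _ hab]

/-- For a process with independent increments, the past up to time `s` is independent of the
increments after time `s`. -/
lemma indepFun_stopPath_increments [IsProbabilityMeasure P] {W : ℝ≥0 → S → E}
    (hm : ∀ t, Measurable (W t)) (h0 : ∀ ω, W 0 ω = 0) (hi : HasIndepIncrements W P) (s : ℝ≥0) :
    IndepFun (fun ω => stopPath s (W · ω)) (fun ω t => W t ω - W (min t s) ω) P := by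
  classical
  refine IndepFun.process_indepFun_process (X := fun t ω => W (min t s) ω)
    (Y := fun t ω => W t ω - W (min t s) ω) (fun t => hm _) (fun t => (hm _).sub (hm _))
    fun I J => ?_
  -- One grid contains `s` and all times involved. Values of the past are sums of increments with
  -- index below `m`, where `t m = s`, and later increments are sums with index at least `m`; these
  -- are disjoint blocks.
  obtain ⟨t, htm, ht0, ht⟩ := exists_monotone_nat_enumeration
    (I.image (min · s) ∪ J.image (max · s) ∪ {s})
  obtain ⟨m, hms⟩ := ht s (by simp)
  have hk : ∀ i : I, ∃ k ≤ m, t k = min (i : ℝ≥0) s := by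
    intro i
    obtain ⟨k, hk⟩ := ht (min (i : ℝ≥0) s)
      (Finset.mem_union_left _ (Finset.mem_union_left _ (Finset.mem_image_of_mem _ i.2)))
    -- The grid may repeat values, so an index of a time at most `s` has to be cut off at `m` by
    -- hand.
    refine ⟨min k m, min_le_right _ _, ?_⟩
    rw [htm.map_min, hk, hms, min_assoc, min_self]
  have hl : ∀ j : J, ∃ k, m ≤ k ∧ t k = max (j : ℝ≥0) s := by
    intro j
    obtain ⟨k, hk⟩ := ht (max (j : ℝ≥0) s)
      (Finset.mem_union_left _ (Finset.mem_union_right _ (Finset.mem_image_of_mem _ j.2)))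
    refine ⟨max k m, le_max_right _ _, ?_⟩
    rw [htm.map_max, hk, hms, max_assoc, max_self]
  choose k hkm hkt using hk
  choose l hlm hlt using hl
  set M := Finset.univ.sup l
  have hind := (hi.nat htm).indepFun_finset (Finset.range m) (Finset.Ico m M)
    (by
      rw [Finset.disjoint_left]
      intro a ha hb
      simp only [Finset.mem_range, Finset.mem_Ico] at ha hb
      omega) fun i => (hm _).sub (hm _)
  have hcomp := hind.comp
    (φ := fun d (i : I) => sumIco (Finset.range m) 0 (k i) d)
    (ψ := fun d (j : J) => sumIco (Finset.Ico m M) m (l j) d)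
    (measurable_pi_lambda _ fun i => measurable_sumIco _ _ _)
    (measurable_pi_lambda _ fun j => measurable_sumIco _ _ _)
  convert hcomp using 1
  · ext ω i
    simp only [Function.comp]
    rw [sumIco_increments (fun l => W (t l) ω) (Nat.zero_le _)
      (fun a ha => by
        simp only [Finset.mem_Ico, Finset.mem_range] at ha ⊢
        exact ha.2.trans_le (hkm i)), hkt, ht0, h0, sub_zero]
  · ext ω j
    simp only [Function.comp]
    rw [sumIco_increments (fun l => W (t l) ω) (hlm j)
      (Finset.Ico_subset_Ico_right (Finset.le_sup (Finset.mem_univ j))), hlt, hms]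
    rcases le_total (j : ℝ≥0) s with h | h
    · simp [min_eq_left h, max_eq_right h]
    · simp [min_eq_right h, max_eq_left h]

/-- The law of a process with independent increments that starts at `0` is determined by the laws
of its increments. -/
lemma map_eq_of_hasIndepIncrements [IsProbabilityMeasure P] {V U : ℝ≥0 → S → E}
    (hV : ∀ t, Measurable (V t)) (hU : ∀ t, Measurable (U t)) (hV0 : ∀ ω, V 0 ω = 0)
    (hU0 : ∀ ω, U 0 ω = 0) (hVi : HasIndepIncrements V P) (hUi : HasIndepIncrements U P)
    (hlaw : ∀ s t, s ≤ t → P.map (V t - V s) = P.map (U t - U s)) :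
    P.map (fun ω => (V · ω)) = P.map (fun ω => (U · ω)) := by
  classical
  rw [map_eq_iff_forall_finset_map_restrict_eq (measurable_pi_lambda _ hV).aemeasurable
    (measurable_pi_lambda _ hU).aemeasurable]
  intro I
  obtain ⟨t, htm, ht0, ht⟩ := exists_monotone_nat_enumeration I
  choose k hk using fun i : I => ht i i.2
  set M := Finset.univ.sup k
  have hinc : ∀ {Z : ℝ≥0 → S → E}, (∀ t, Measurable (Z t)) → ∀ i,
      Measurable fun ω => Z (t (i + 1)) ω - Z (t i) ω := fun hZ i => (hZ _).sub (hZ _)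
  have hvec : ∀ {Z : ℝ≥0 → S → E}, (∀ t, Measurable (Z t)) →
      Measurable fun ω (i : Finset.range M) => Z (t (i + 1)) ω - Z (t i) ω := fun hZ =>
    measurable_pi_lambda _ fun i => hinc hZ i
  have hpi : ∀ {Z : ℝ≥0 → S → E}, (∀ t, Measurable (Z t)) → HasIndepIncrements Z P →
      P.map (fun ω (i : Finset.range M) => Z (t (i + 1)) ω - Z (t i) ω) =
        Measure.pi fun i : Finset.range M => P.map (Z (t (i + 1)) - Z (t i)) := fun {Z} hZ hZi =>
    (iIndepFun_iff_map_fun_eq_pi_map (f := fun (i : Finset.range M) => Z (t (i + 1)) - Z (t i))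
      fun i => (hinc hZ i).aemeasurable).1
      ((hZi.nat htm).precomp Subtype.val_injective)
  have heq : P.map (fun ω (i : Finset.range M) => V (t (i + 1)) ω - V (t i) ω) =
      P.map (fun ω (i : Finset.range M) => U (t (i + 1)) ω - U (t i) ω) := by
    rw [hpi hV hVi, hpi hU hUi]
    exact congrArg Measure.pi (funext fun i : Finset.range M =>
      hlaw (t i) (t (i + 1)) (htm (Nat.le_succ i)))
  have hφ : Measurable fun (d : Finset.range M → E) (i : I) => sumIco (Finset.range M) 0 (k i) d :=
    measurable_pi_lambda _ fun i => measurable_sumIco _ _ _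
  have hres : ∀ {Z : ℝ≥0 → S → E}, (∀ ω, Z 0 ω = 0) → (fun ω => I.restrict (Z · ω)) =
      (fun (d : Finset.range M → E) (i : I) => sumIco (Finset.range M) 0 (k i) d) ∘
        fun ω (i : Finset.range M) => Z (t (i + 1)) ω - Z (t i) ω := by
    intro Z hZ0
    ext ω i
    simp only [Function.comp, Finset.restrict]
    rw [sumIco_increments (fun l => Z (t l) ω) (Nat.zero_le _)
      (by
        rw [Finset.range_eq_Ico]
        exact Finset.Ico_subset_Ico_right (Finset.le_sup (Finset.mem_univ i))), hk, ht0, hZ0,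
      sub_zero]
  rw [hres hV0, hres hU0, ← Measure.map_map hφ (hvec hV), heq, Measure.map_map hφ (hvec hU)]

end Increments

/-! ### Regular versions and isometry invariance of the Wiener process -/

section Wiener

variable {d : ℕ} {S : Type*} [MeasurableSpace S] {P : Measure S}

local notation "E" => EuclideanSpace ℝ (Fin d)

lemma IsWienerProcess.aemeasurable {W : ℝ≥0 → S → E} (hW : IsWienerProcess W P) (t : ℝ≥0) :
    AEMeasurable (W t) P := by
  have h0 : AEMeasurable (W 0) P := aemeasurable_const.congr (f := fun _ => (0 : E))
    (by filter_upwards [hW.start] with ω hω using hω.symm)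
  rcases eq_or_lt_of_le (zero_le (a := t)) with h | h
  · rwa [← h]
  · simpa using (hW.law 0 t h).aemeasurable.add h0

lemma IsWienerProcess.congr {W W' : ℝ≥0 → S → E} (hW : IsWienerProcess W P)
    (h : ∀ᵐ ω ∂P, ∀ t, W' t ω = W t ω) : IsWienerProcess W' P where
  start := by filter_upwards [h, hW.start] with ω h1 h2 using (h1 0).trans h2
  indep := fun n t ht => (hW.indep n t ht).congr fun i => by
    filter_upwards [h] with ω hω
    rw [hω, hω]
  law := fun s t hst => (hW.law s t hst).congr (by
    filter_upwards [h] with ω hω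
    simp [hω])
  cont := by
    filter_upwards [h, hW.cont] with ω h1 h2
    simpa [h1] using h2

/-- A Wiener process agrees almost surely with one that is everywhere continuous, starts everywhere
at `0` and is measurable. -/
lemma IsWienerProcess.exists_regular {W : ℝ≥0 → S → E} (hW : IsWienerProcess W P) :
    ∃ W' : ℝ≥0 → S → E, (∀ t, Measurable (W' t)) ∧ (∀ ω, Continuous (W' · ω)) ∧
      (∀ ω, W' 0 ω = 0) ∧ ∀ᵐ ω ∂P, ∀ t, W' t ω = W t ω := by
  classical
  let q := TopologicalSpace.denseSeq ℝ≥0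
  have hae : ∀ᵐ ω ∂P, (∀ k, W (q k) ω = (hW.aemeasurable (q k)).mk _ ω) ∧ W 0 ω = 0 ∧
      Continuous fun t => W t ω := by
    filter_upwards [ae_all_iff.2 fun k => (hW.aemeasurable (q k)).ae_eq_mk, hW.start, hW.cont]
      with ω h1 h2 h3 using ⟨h1, h2, h3⟩
  obtain ⟨G, hGP, hGm, hG⟩ : ∃ G : Set S, (∀ ω ∈ G, (∀ k, W (q k) ω =
      (hW.aemeasurable (q k)).mk _ ω) ∧ W 0 ω = 0 ∧ Continuous fun t => W t ω) ∧
      MeasurableSet G ∧ ∀ᵐ ω ∂P, ω ∈ G := by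
    -- The good event need not be measurable, so the bad one is enlarged to a measurable null set,
    -- off which the paths are kept.
    obtain ⟨N, hN, hNm, hN0⟩ := exists_measurable_superset_of_null hae
    refine ⟨Nᶜ, fun ω hω => ?_, hNm.compl, ?_⟩
    · by_contra h
      exact hω (hN h)
    · exact measure_eq_zero_iff_ae_notMem.1 hN0
  let W' : ℝ≥0 → S → E := fun t => G.indicator (W t)
  have hcont : ∀ ω, Continuous (W' · ω) := by
    intro ω
    by_cases hω : ω ∈ G
    · simpa [W', hω] using (hGP ω hω).2.2
    · simpa [W', hω] using continuous_const
  have hqm : ∀ k, Measurable (W' (q k)) := by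
    intro k
    have : W' (q k) = G.indicator ((hW.aemeasurable (q k)).mk _) := by
      ext1 ω
      by_cases hω : ω ∈ G
      · simp [W', hω, (hGP ω hω).1 k]
      · simp [W', hω]
    rw [this]
    exact (hW.aemeasurable (q k)).measurable_mk.indicator hGm
  refine ⟨W', fun t => ?_, hcont, fun ω => ?_, ?_⟩
  · obtain ⟨u, hu, hut⟩ := mem_closure_iff_seq_limit.1
      ((TopologicalSpace.denseRange_denseSeq ℝ≥0) t)
    choose k hk using hu
    refine measurable_of_tendsto_metrizable (f := fun n => W' (u n)) (fun n => ?_)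
      (tendsto_pi_nhds.2 fun ω => ((hcont ω).tendsto t).comp hut)
    rw [← hk n]
    exact hqm _
  · by_cases hω : ω ∈ G
    · simpa [W', hω] using (hGP ω hω).2.1
    · simp [W', hω]
  · filter_upwards [hG] with ω hω t
    simp [W', hω]

/-- The centred Gaussian density depends only on the norm, and Lebesgue measure is invariant under
isometries. -/
lemma IsWienerProcess.map_isometry_sub {W : ℝ≥0 → S → E} (hW : IsWienerProcess W P)
    (hm : ∀ t, Measurable (W t)) (L : E ≃ₗᵢ[ℝ] E) {s t : ℝ≥0} (hst : s ≤ t) :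
    P.map ((fun ω => L (W t ω)) - fun ω => L (W s ω)) = P.map (W t - W s) := by
  rcases eq_or_lt_of_le hst with rfl | h
  · simp
  have hcomp : ((fun ω => L (W t ω)) - fun ω => L (W s ω)) = L ∘ (W t - W s) := by
    ext1 ω
    simp
  rw [hcomp, ← Measure.map_map L.continuous.measurable ((hm t).sub (hm s)), (hW.law s t h).map_eq]
  refine Measure.ext fun C hC => ?_
  rw [Measure.map_apply L.continuous.measurable hC, withDensity_apply _ hC,
    withDensity_apply _ (L.continuous.measurable hC)]
  have h := L.measurePreserving.setLIntegral_comp_preimage_emb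
    L.toHomeomorph.measurableEmbedding
    (fun z => ENNReal.ofReal (gaussianKernel ((t : ℝ) - s) 0 z)) C
  simpa [gaussianKernel] using h

/-- The law of a Wiener process is invariant under linear isometries. -/
lemma IsWienerProcess.map_isometry [IsProbabilityMeasure P] {W : ℝ≥0 → S → E}
    (hW : IsWienerProcess W P) (hm : ∀ t, Measurable (W t)) (h0 : ∀ ω, W 0 ω = 0)
    (L : E ≃ₗᵢ[ℝ] E) :
    P.map (fun ω t => L (W t ω)) = P.map (fun ω => (W · ω)) :=
  map_eq_of_hasIndepIncrements (V := fun t ω => L (W t ω))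
    (fun t => L.continuous.measurable.comp (hm t)) hm (fun ω => by simp [h0]) h0
    (hW.indep.map (L : E →L[ℝ] E)) hW.indep fun _ _ hst => hW.map_isometry_sub hm L hst

end Wiener

/-! ### Bounds for the Gaussian kernel -/

section GaussianKernel

variable {d : ℕ}

local notation "E" => EuclideanSpace ℝ (Fin d)

lemma gaussianKernel_nonneg {s : ℝ} (hs : 0 ≤ s) (x y : E) : 0 ≤ gaussianKernel s x y := by
  unfold gaussianKernel
  positivity

lemma continuous_gaussianKernel (s : ℝ) (x : E) : Continuous (gaussianKernel s x) := by
  unfold gaussianKernel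
  fun_prop

lemma measurable_gaussianKernel :
    Measurable fun q : ℝ × E × E => gaussianKernel q.1 q.2.1 q.2.2 := by
  unfold gaussianKernel
  fun_prop

/-- Away from the diagonal the Gaussian kernel is bounded uniformly in time. -/
lemma exists_gaussianKernel_le {δ : ℝ} (hδ : 0 < δ) : ∃ C : ℝ, ∀ s : ℝ, 0 < s →
    ∀ x y : E, δ ≤ ‖x - y‖ → gaussianKernel s x y ≤ C := by
  -- With `u = δ² / (2s)` the prefactor is `(πδ²)^(-d/2) u^(d/2)` and the exponential is at most
  -- `exp (-u)`. The factor `1 + d!` bounds `u^(d/2) exp (-u)`: use `u^(d/2) ≤ 1` for `u ≤ 1` and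
  -- `u^(d/2) ≤ u^d ≤ d! exp u` for `u ≥ 1`.
  refine ⟨(Real.pi * δ ^ 2) ^ (-(d : ℝ) / 2) * (1 + d.factorial), fun s hs x y hxy => ?_⟩
  have hpi := Real.pi_pos
  set u : ℝ := δ ^ 2 / (2 * s) with hu
  have hupos : 0 < u := by positivity
  have h1 : 2 * Real.pi * s = Real.pi * δ ^ 2 * u⁻¹ := by
    rw [hu]
    field_simp
  have h2 : (2 * Real.pi * s) ^ (-(d : ℝ) / 2) =
      (Real.pi * δ ^ 2) ^ (-(d : ℝ) / 2) * u ^ ((d : ℝ) / 2) := by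
    rw [h1, Real.mul_rpow (by positivity) (by positivity), Real.inv_rpow hupos.le,
      ← Real.rpow_neg hupos.le, neg_div, neg_neg]
  have h3 : Real.exp (-‖x - y‖ ^ 2 / (2 * s)) ≤ Real.exp (-u) := by
    rw [Real.exp_le_exp, neg_div, neg_le_neg_iff, hu]
    gcongr
  have h4 : u ^ ((d : ℝ) / 2) ≤ (1 + d.factorial) * Real.exp u := by
    have hexp : 1 ≤ Real.exp u := Real.one_le_exp hupos.le
    have hpow : u ^ d ≤ d.factorial * Real.exp u := by
      have := Real.pow_div_factorial_le_exp u hupos.le d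
      rwa [div_le_iff₀ (by positivity), mul_comm] at this
    rcases le_total u 1 with h | h
    · have : u ^ ((d : ℝ) / 2) ≤ 1 := Real.rpow_le_one hupos.le h (by positivity)
      nlinarith [Real.exp_pos u, (Nat.cast_nonneg d.factorial : (0 : ℝ) ≤ d.factorial)]
    · have : u ^ ((d : ℝ) / 2) ≤ u ^ d := by
        rw [← Real.rpow_natCast]
        exact Real.rpow_le_rpow_of_exponent_le h (by
          have : (0 : ℝ) ≤ d := Nat.cast_nonneg d
          linarith)
      linarith
  unfold gaussianKernel
  rw [h2, mul_assoc]
  refine mul_le_mul_of_nonneg_left ?_ (by positivity)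
  calc u ^ ((d : ℝ) / 2) * Real.exp (-‖x - y‖ ^ 2 / (2 * s))
      ≤ ((1 + d.factorial) * Real.exp u) * Real.exp (-u) := by gcongr
    _ = 1 + d.factorial := by
      rw [mul_assoc, ← Real.exp_add, add_neg_cancel, Real.exp_zero, mul_one]

end GaussianKernel

/-! ### The exit time in terms of survival of the path -/

section ExitTime

variable {d : ℕ} {S : Type*}

lemma lt_exitTime_iff {W : ℝ≥0 → S → EuclideanSpace ℝ (Fin d)}
    {D : Set (EuclideanSpace ℝ (Fin d))} (hD : IsOpen D) (x : EuclideanSpace ℝ (Fin d)) {ω : S}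
    (hω : Continuous fun t => W t ω) (t : ℝ≥0) :
    (t : WithTop ℝ≥0) < exitTime W D x ω ↔ ∀ s ≤ t, x + W s ω ∈ D := by
  unfold exitTime hittingAfter
  have hclosed : IsClosed {i : ℝ≥0 | 0 ≤ i ∧ x + W i ω ∈ Dᶜ} := by
    have h : Continuous fun i => x + W i ω := by fun_prop
    simp only [zero_le, true_and]
    exact hD.isClosed_compl.preimage h
  split_ifs with h
  · rw [WithTop.coe_lt_coe]
    constructor
    · intro ht s hs
      by_contra hn
      exact absurd (ht.trans_le (csInf_le (OrderBot.bddBelow _) ⟨zero_le, hn⟩)) (not_lt.2 hs)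
    · intro hall
      by_contra hn
      exact (hclosed.csInf_mem h (OrderBot.bddBelow _)).2 (hall _ (not_lt.1 hn))
  · push Not at h
    simp only [WithTop.coe_lt_top, true_iff]
    intro s _
    simpa using h s zero_le

end ExitTime

/-! ### Hunt's formula and regularity of the exit term -/

section Hunt

variable {d : ℕ} {S : Type*} [MeasurableSpace S] {P : Measure S}

local notation "E" => EuclideanSpace ℝ (Fin d)

lemma IsWienerProcess.measure_add_sub_mem {W : ℝ≥0 → S → E} (hW : IsWienerProcess W P)
    (hm : ∀ t, Measurable (W t)) {s t : ℝ≥0} (hst : s < t) (z : E) {A : Set E}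
    (hA : MeasurableSet A) :
    P {ω | z + (W t ω - W s ω) ∈ A} =
      ∫⁻ y in A, ENNReal.ofReal (gaussianKernel ((t : ℝ) - s) z y) := by
  have hpre : MeasurableSet ((z + ·) ⁻¹' A) := (measurable_const_add z) hA
  have h1 := congrArg (fun μ => μ ((z + ·) ⁻¹' A)) (hW.law s t hst).map_eq
  simp only [Measure.map_apply ((hm t).sub (hm s)) hpre, withDensity_apply _ hpre] at h1
  have h2 := (measurePreserving_add_left (volume : Measure E) z).setLIntegral_comp_preimage_emb
    (measurableEmbedding_addLeft z)
    (fun y => ENNReal.ofReal (gaussianKernel ((t : ℝ) - s) z y)) A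
  rw [← h2]
  refine Eq.trans ?_ (h1.trans ?_)
  · rfl
  · simp [gaussianKernel]

/-- The increments of a Wiener process after a fixed time can be replaced with those of an
independent copy. -/
lemma IsWienerProcess.map_independent_copy [IsProbabilityMeasure P] {W : ℝ≥0 → S → E}
    (hW : IsWienerProcess W P) (hm : ∀ t, Measurable (W t)) (h0 : ∀ ω, W 0 ω = 0) (x : E)
    (s : ℝ≥0) :
    (P.prod P).map (fun p => (stopPath s (fun t => x + W t p.1),
        fun t => W t p.2 - W (min t s) p.2)) =
      (P.prod P).map (fun p => (stopPath s (fun t => x + W t p.1),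
        fun t => (x + W t p.1) - (x + W (min t s) p.1))) := by
  have hind := (indepFun_stopPath_increments hm h0 hW.indep s).comp
    (φ := fun w t => x + w t) (ψ := id)
    (measurable_pi_lambda _ fun t => measurable_const.add (measurable_pi_apply t)) measurable_id
  have hf : Measurable ((fun (w : ℝ≥0 → E) t => x + w t) ∘ fun ω => stopPath s (W · ω)) :=
    measurable_pi_lambda _ fun t => (hm _).const_add x
  have hg : Measurable (id ∘ fun ω t => W t ω - W (min t s) ω) :=
    measurable_pi_lambda _ fun t => (hm _).sub (hm _)
  have h1 := (indepFun_iff_map_prod_eq_prod_map_map hf.aemeasurable hg.aemeasurable).1 hind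
  rw [Measure.map_prod_map _ _ hf hg] at h1
  -- By independence the joint law of past and own increments is a product, hence it is also the law
  -- of the past of one copy with the increments of the other.
  have hr := Measure.map_map (μ := P.prod P) (hf.prodMk hg) measurable_fst
  rw [Measure.map_fst_prod, measure_univ, one_smul, h1] at hr
  refine Eq.trans ?_ (hr.trans ?_)
  · rfl
  · congr 1
    ext1 p
    simp only [Function.comp, Prod.mk.injEq, id]
    refine ⟨rfl, ?_⟩
    ext1 t
    abel

/-- The Gaussian kernel for the time that remains until `t`, started from the place where the path
`ω` from `x` leaves `D`, and `0` if the path does not leave `D` before `t`. -/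
def exitKernel (W : ℝ≥0 → S → E) (D : Set E) (t : ℝ≥0) (x : E) (ω : S) (y : E) : ENNReal :=
  {ω | exitBefore D t (fun s => x + W s ω) < t}.indicator (fun ω => ENNReal.ofReal
    (gaussianKernel ((t : ℝ) - exitBefore D t (fun s => x + W s ω))
      (x + W (exitBefore D t (fun s => x + W s ω)) ω) y)) ω

/-- The part of the transition density of a Wiener process from `x` that is carried by the paths
that leave `D` before time `t`. -/
def exitDensity (P : Measure S) (W : ℝ≥0 → S → E) (D : Set E) (t : ℝ≥0) (x y : E) : ENNReal :=
  ∫⁻ ω, exitKernel W D t x ω y ∂P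

lemma measurable_exitBefore {W : ℝ≥0 → S → E} (hm : ∀ t, Measurable (W t)) (hc : ∀ ω, Continuous (W · ω))
    {D : Set E} (hD : IsOpen D) (t : ℝ≥0) (x : E) :
    Measurable fun ω => exitBefore D t (fun s => x + W s ω) :=
  measurable_of_le_iff_stopPath_mem (V := fun s ω => x + W s ω) (fun s => (hm s).const_add x)
    (exitBefore_le_iff_stopPath_mem (V := fun s ω => x + W s ω)
      (fun ω => continuous_const.add (hc ω)) hD t)

lemma measurable_exitKernel {W : ℝ≥0 → S → E} (hm : ∀ t, Measurable (W t))
    (hc : ∀ ω, Continuous (W · ω)) {D : Set E} (hD : IsOpen D) (t : ℝ≥0) (x : E) :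
    Measurable (Function.uncurry (exitKernel W D t x)) := by
  have hT := measurable_exitBefore hm hc hD t x
  have hWT : Measurable fun ω => W (exitBefore D t (fun s => x + W s ω)) ω :=
    (measurable_uncurry_of_continuous_of_measurable hc hm).comp (hT.prodMk measurable_id)
  have hset : MeasurableSet {ω | exitBefore D t (fun s => x + W s ω) < t} :=
    measurableSet_lt hT measurable_const
  have hker : Measurable fun p : S × E => ENNReal.ofReal
      (gaussianKernel ((t : ℝ) - exitBefore D t (fun s => x + W s p.1))
        (x + W (exitBefore D t (fun s => x + W s p.1)) p.1) p.2) :=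
    (measurable_gaussianKernel.comp
      ((measurable_const.sub (hT.comp measurable_fst).coe_nnreal_real).prodMk
        (((hWT.comp measurable_fst).const_add x).prodMk measurable_snd))).ennreal_ofReal
  exact hker.indicator (measurable_fst hset)

lemma measurable_exitDensity [SFinite P] {W : ℝ≥0 → S → E} (hm : ∀ t, Measurable (W t))
    (hc : ∀ ω, Continuous (W · ω)) {D : Set E} (hD : IsOpen D) (t : ℝ≥0) (x : E) :
    Measurable (exitDensity P W D t x) :=
  (measurable_exitKernel hm hc hD t x).lintegral_prod_left'

/-- The exit point is outside `D`, hence at distance at least `δ` from `y`, so the off-diagonal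
bound applies however little time remains. -/
lemma exitKernel_le {W : ℝ≥0 → S → E} (hc : ∀ ω, Continuous (W · ω)) {D : Set E} (hD : IsOpen D)
    {t : ℝ≥0} {x y : E} {δ C : ℝ} (hδ : Metric.ball y δ ⊆ D)
    (hC : ∀ s : ℝ, 0 < s → ∀ x y : E, δ ≤ ‖x - y‖ → gaussianKernel s x y ≤ C) (ω : S) :
    exitKernel W D t x ω y ≤ ENNReal.ofReal C := by
  refine Set.indicator_apply_le' (fun hlt => ?_) fun _ => zero_le
  refine ENNReal.ofReal_le_ofReal (hC _ (sub_pos.2 (NNReal.coe_lt_coe.2 hlt)) _ _ ?_)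
  have hnot : ¬ ∀ s ≤ t, x + W s ω ∈ D := fun hall =>
    (ne_of_lt (show exitBefore D t (fun s => x + W s ω) < t from hlt))
      (exitBefore_eq_of_forall_mem hall)
  have hout := apply_exitBefore_notMem hD (w := fun s => x + W s ω)
    (continuous_const.add (hc ω)) hnot
  by_contra hd
  exact hout (hδ (by rw [Metric.mem_ball, dist_eq_norm]; exact not_le.1 hd))

lemma continuous_exitKernel (W : ℝ≥0 → S → E) (D : Set E) (t : ℝ≥0) (x : E) (ω : S) :
    Continuous (exitKernel W D t x ω) := by
  unfold exitKernel Set.indicator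
  split_ifs
  · exact ENNReal.continuous_ofReal.comp (continuous_gaussianKernel _ _)
  · exact continuous_const

lemma exitDensity_lt_top [IsProbabilityMeasure P] {W : ℝ≥0 → S → E}
    (hc : ∀ ω, Continuous (W · ω)) {D : Set E} (hD : IsOpen D) (t : ℝ≥0) (x : E) {y : E}
    (hy : y ∈ D) : exitDensity P W D t x y < ⊤ := by
  obtain ⟨δ, hδ, hball⟩ := Metric.isOpen_iff.1 hD y hy
  obtain ⟨C, hC⟩ := exists_gaussianKernel_le (d := d) hδ
  refine (lintegral_mono fun ω => exitKernel_le hc hD hball hC ω).trans_lt ?_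
  simp

lemma continuousAt_exitDensity [IsProbabilityMeasure P] {W : ℝ≥0 → S → E}
    (hm : ∀ t, Measurable (W t)) (hc : ∀ ω, Continuous (W · ω)) {D : Set E} (hD : IsOpen D)
    (t : ℝ≥0) (x : E) {y : E} (hy : y ∈ D) : ContinuousAt (exitDensity P W D t x) y := by
  obtain ⟨δ, hδ, hball⟩ := Metric.isOpen_iff.1 hD y hy
  -- Half the radius leaves room for one bound valid for all points near `y`, as dominated
  -- convergence requires.
  obtain ⟨C, hC⟩ := exists_gaussianKernel_le (d := d) (half_pos hδ)
  refine tendsto_lintegral_filter_of_dominated_convergence (fun _ => ENNReal.ofReal C)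
    (Eventually.of_forall fun z => ?_) ?_ (by simp)
    (ae_of_all _ fun ω => (continuous_exitKernel W D t x ω).tendsto y)
  · exact (measurable_exitKernel hm hc hD t x).of_uncurry_right
  · filter_upwards [Metric.ball_mem_nhds y (half_pos hδ)] with z hz
    refine ae_of_all _ fun ω => exitKernel_le hc hD ?_ hC ω
    refine (Metric.ball_subset_ball' ?_).trans hball
    have := (Metric.mem_ball.1 hz).le
    linarith

/-- **Hunt's formula**, for the paths that leave `D`. -/
lemma IsWienerProcess.measure_exit [IsProbabilityMeasure P] {W : ℝ≥0 → S → E} (hW : IsWienerProcess W P)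
    (hm : ∀ t, Measurable (W t)) (hc : ∀ ω, Continuous (W · ω)) (h0 : ∀ ω, W 0 ω = 0)
    {D : Set E} (hD : IsOpen D) (t : ℝ≥0) (x : E) {A : Set E} (hA : MeasurableSet A)
    (hAD : A ⊆ D) :
    P {ω | (¬ ∀ s ≤ t, x + W s ω ∈ D) ∧ x + W t ω ∈ A} = ∫⁻ y in A, exitDensity P W D t x y := by
  let V : ℝ≥0 → S × S → E := fun s p => x + W s p.1
  let X : ℝ≥0 → S × S → E := fun s p => W s p.2
  let τ : S → ℝ≥0 := fun ω => exitBefore D t (fun s => x + W s ω)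
  have hV : ∀ s, Measurable (V s) := fun s => ((hm s).comp measurable_fst).const_add x
  have hX : ∀ s, Measurable (X s) := fun s => (hm s).comp measurable_snd
  have hVc : ∀ p, Continuous (V · p) := fun p => continuous_const.add (hc p.1)
  have hXc : ∀ p, Continuous (X · p) := fun p => hc p.2
  have hτ : Measurable τ := measurable_exitBefore hm hc hD t x
  have hlaw := map_splice_eq hV hX hVc hXc (hW.map_independent_copy hm h0 x)
    (T := fun p => exitBefore D t (V · p)) (exitBefore_le_iff_stopPath_mem hVc hD t)
  have hWu : Measurable (Function.uncurry W) :=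
    measurable_uncurry_of_continuous_of_measurable hc hm
  have hstay : MeasurableSet {ω | ∀ s ≤ t, x + W s ω ∈ D} :=
    measurableSet_stay (V := fun s ω => x + W s ω) (fun s => (hm s).const_add x)
      (fun ω => continuous_const.add (hc ω)) hD t
  have hU : ∀ s, Measurable fun p => splice (exitBefore D t (V · p)) (V · p) (X · p) s := by
    intro s
    have hτ1 : Measurable fun p : S × S => min s (τ p.1) :=
      measurable_const.min (hτ.comp measurable_fst)
    exact ((hWu.comp (hτ1.prodMk measurable_fst)).const_add x).add
      ((hX s).sub (hWu.comp (hτ1.prodMk measurable_snd)))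
  have hUp : Measurable fun p => splice (exitBefore D t (V · p)) (V · p) (X · p) :=
    measurable_pi_lambda _ hU
  have hVp : Measurable fun p => (V · p) := measurable_pi_lambda _ hV
  have hK : MeasurableSet ((staySet D t)ᶜ ∩ (fun w : ℝ≥0 → E => w t) ⁻¹' A) :=
    (measurableSet_staySet D t).compl.inter (measurable_pi_apply t hA)
  have h1 := congrArg (fun μ => μ ((staySet D t)ᶜ ∩ (fun w : ℝ≥0 → E => w t) ⁻¹' A)) hlaw
  simp only [Measure.map_apply hUp hK, Measure.map_apply hVp hK] at h1
  have hR : (fun p => (V · p)) ⁻¹' ((staySet D t)ᶜ ∩ (fun w : ℝ≥0 → E => w t) ⁻¹' A) =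
      Prod.fst ⁻¹' {ω | (¬ ∀ s ≤ t, x + W s ω ∈ D) ∧ x + W t ω ∈ A} := by
    ext p
    simp only [Set.mem_preimage, Set.mem_inter_iff, Set.mem_compl_iff, mem_staySet_iff hD (hVc p)]
    rfl
  have hevent : MeasurableSet {ω | (¬ ∀ s ≤ t, x + W s ω ∈ D) ∧ x + W t ω ∈ A} :=
    hstay.compl.inter (((hm t).const_add x) hA)
  rw [hR, (measurePreserving_fst (μ := P) (ν := P)).measure_preimage
    hevent.nullMeasurableSet] at h1
  -- Fubini: freeze the path `ω` up to its exit and integrate over the independent continuation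
  -- `ω'`, whose Gaussian law yields `exitKernel`.
  rw [← h1, Measure.prod_apply (hUp hK)]
  unfold exitDensity
  rw [lintegral_lintegral_swap (f := fun y ω => exitKernel W D t x ω y)
    ((measurable_exitKernel hm hc hD t x).comp measurable_swap).aemeasurable]
  refine lintegral_congr fun ω => ?_
  have hsec : Prod.mk ω ⁻¹' ((fun p => splice (exitBefore D t (V · p)) (V · p) (X · p)) ⁻¹'
      ((staySet D t)ᶜ ∩ (fun w : ℝ≥0 → E => w t) ⁻¹' A)) =
      {ω' | (¬ ∀ s ≤ t, x + W s ω ∈ D) ∧ (x + W (τ ω) ω) + (W t ω' - W (τ ω) ω') ∈ A} := by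
    ext ω'
    simp only [Set.mem_preimage, Set.mem_inter_iff, Set.mem_compl_iff,
      mem_staySet_iff hD (continuous_splice _ (hVc (ω, ω')) (hXc (ω, ω'))),
      forall_splice_exitBefore_mem_iff hD (hVc (ω, ω')),
      splice_of_ge _ _ (exitBefore_le D t (V · (ω, ω')))]
    rfl
  rw [hsec]
  by_cases hlt : τ ω < t
  · have hnot : ¬ ∀ s ≤ t, x + W s ω ∈ D := fun hall =>
      hlt.ne (exitBefore_eq_of_forall_mem hall)
    have hmem : ω ∈ {ω | exitBefore D t (fun s => x + W s ω) < t} := hlt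
    simp only [hnot, not_false_eq_true, true_and, exitKernel, Set.indicator_of_mem hmem]
    exact hW.measure_add_sub_mem hm hlt _ hA
  · have hnmem : ω ∉ {ω | exitBefore D t (fun s => x + W s ω) < t} := hlt
    simp only [exitKernel, Set.indicator_of_notMem hnmem, lintegral_const, zero_mul]
    -- A path that first exits exactly at `t` ends outside `D ⊇ A` and contributes nothing, in
    -- agreement with the value `0` of `exitKernel`.
    have heq : τ ω = t := le_antisymm (exitBefore_le _ _ _) (not_lt.1 hlt)
    convert measure_empty (μ := P)
    refine Set.eq_empty_of_forall_notMem fun ω' h => ?_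
    have hout := apply_exitBefore_notMem hD (w := fun s => x + W s ω)
      (continuous_const.add (hc ω)) h.1
    have h2 := h.2
    rw [heq, sub_self, add_zero] at h2
    change x + W (τ ω) ω ∉ D at hout
    rw [heq] at hout
    exact hout (hAD h2)

end Hunt

/-! ### Existence of a continuous transition density -/

section Existence

variable {d : ℕ} {S : Type*} [MeasurableSpace S] {P : Measure S}

local notation "E" => EuclideanSpace ℝ (Fin d)

/-- Passes from `W` to its regular version. The two events differ by a null set, so no measurability
is needed. -/
lemma measure_killed_eq {W W' : ℝ≥0 → S → E} (hc : ∀ ω, Continuous (W' · ω))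
    (h : ∀ᵐ ω ∂P, ∀ t, W' t ω = W t ω) {D : Set E} (hD : IsOpen D) (x : E) (t : ℝ≥0) (A : Set E) :
    P {ω | (t : WithTop ℝ≥0) < exitTime W D x ω ∧ x + W t ω ∈ A} =
      P {ω | (∀ s ≤ t, x + W' s ω ∈ D) ∧ x + W' t ω ∈ A} := by
  refine measure_congr (eventuallyEq_set.2 ?_)
  filter_upwards [h] with ω hω
  have hcW : Continuous fun t => W t ω := by simpa [hω] using hc ω
  simp only [lt_exitTime_iff hD x hcW, hω]

/-- A Wiener process killed on leaving an open set has a transition density that is continuous in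
its last variable. -/
theorem IsWienerProcess.exists_isContinuousKilledTransitionDensity [IsProbabilityMeasure P]
    {W : ℝ≥0 → S → E} (hW : IsWienerProcess W P) {D : Set E} (hD : IsOpen D) :
    ∃ g, IsContinuousKilledTransitionDensity W P D g := by
  obtain ⟨W', hm, hc, h0, hae⟩ := hW.exists_regular
  have hW' := hW.congr hae
  have hker : ∀ t : ℝ≥0, 0 < t → ∀ (x : E) (A : Set E), MeasurableSet A →
      ∫⁻ y in A, ENNReal.ofReal (gaussianKernel t x y) = P {ω | x + W' t ω ∈ A} := by
    intro t ht x A hA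
    have := hW'.measure_add_sub_mem hm ht x hA
    simpa [h0] using this.symm
  have hnn : ∀ (t : ℝ≥0) (x : E) (A : Set E),
      0 ≤ᵐ[volume.restrict A] gaussianKernel (t : ℝ) x :=
    fun t x A => ae_of_all _ fun y => gaussianKernel_nonneg t.2 x y
  have hker_int : ∀ t : ℝ≥0, 0 < t → ∀ (x : E) (A : Set E), MeasurableSet A →
      IntegrableOn (gaussianKernel t x) A := by
    intro t ht x A hA
    refine ⟨(continuous_gaussianKernel _ x).aestronglyMeasurable, ?_⟩
    rw [hasFiniteIntegral_iff_ofReal (hnn t x A),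
      hker t ht x A hA]
    exact measure_lt_top _ _
  have hexit : ∀ (t : ℝ≥0) (x : E) (A : Set E), MeasurableSet A → A ⊆ D →
      ∫⁻ y in A, exitDensity P W' D t x y ≠ ⊤ := by
    intro t x A hA hAD
    rw [← hW'.measure_exit hm hc h0 hD t x hA hAD]
    exact measure_ne_top _ _
  have hexit_int : ∀ (t : ℝ≥0) (x : E) (A : Set E), MeasurableSet A → A ⊆ D →
      IntegrableOn (fun y => (exitDensity P W' D t x y).toReal) A := fun t x A hA hAD =>
    integrable_toReal_of_lintegral_ne_top (measurable_exitDensity hm hc hD t x).aemeasurable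
      (hexit t x A hA hAD)
  refine ⟨fun t x y => gaussianKernel t x y - (exitDensity P W' D t x y).toReal,
    { integrable := fun t ht x _ => (hker_int t ht x D hD.measurableSet).sub
        (hexit_int t x D hD.measurableSet le_rfl)
      density := fun t ht x _ A hA hAD => ?_
      continuousOn := fun t _ x _ => ?_ }⟩
  · rw [integral_sub (hker_int t ht x A hA) (hexit_int t x A hA hAD),
      integral_eq_lintegral_of_nonneg_ae (hnn t x A)
        (continuous_gaussianKernel _ x).aestronglyMeasurable, hker t ht x A hA,
      integral_toReal (measurable_exitDensity hm hc hD t x).aemeasurable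
        ((ae_restrict_iff' hA).2 (ae_of_all _ fun y hy => exitDensity_lt_top hc hD t x (hAD hy))),
      ← hW'.measure_exit hm hc h0 hD t x hA hAD, Measure.real, measure_killed_eq hc hae hD]
    have hstay : MeasurableSet {ω | ∀ s ≤ t, x + W' s ω ∈ D} :=
      measurableSet_stay (V := fun s ω => x + W' s ω) (fun s => (hm s).const_add x)
        (fun ω => continuous_const.add (hc ω)) hD t
    have hsplit := measure_inter_add_sdiff (μ := P) {ω | x + W' t ω ∈ A} hstay
    have h1 : {ω | x + W' t ω ∈ A} ∩ {ω | ∀ s ≤ t, x + W' s ω ∈ D} =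
        {ω | (∀ s ≤ t, x + W' s ω ∈ D) ∧ x + W' t ω ∈ A} := by
      ext ω
      exact and_comm
    have h2 : {ω | x + W' t ω ∈ A} \ {ω | ∀ s ≤ t, x + W' s ω ∈ D} =
        {ω | (¬ ∀ s ≤ t, x + W' s ω ∈ D) ∧ x + W' t ω ∈ A} := by
      ext ω
      exact and_comm
    rw [h1, h2] at hsplit
    rw [← hsplit, ENNReal.toReal_add (measure_ne_top _ _) (measure_ne_top _ _),
      add_sub_cancel_right]
  · refine (continuous_gaussianKernel _ x).continuousOn.sub fun y hy => ?_
    exact ((ENNReal.tendsto_toReal (exitDensity_lt_top hc hD t x hy).ne).comp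
      (continuousAt_exitDensity hm hc hD t x hy)).mono_left nhdsWithin_le_nhds

end Existence

/-! ### The reflection principle -/

section Reflection

variable {d : ℕ} {S : Type*} [MeasurableSpace S] {P : Measure S}

local notation "E" => EuclideanSpace ℝ (Fin d)

lemma hyperplaneReflection_eq (v x : E) :
    hyperplaneReflection v x = (ℝ ∙ v)ᗮ.reflection x := by
  rw [Submodule.reflection_orthogonal_apply, Submodule.reflection_singleton_apply]
  simp only [hyperplaneReflection, RCLike.ofReal_real_eq_id, id_eq, neg_sub]
  rw [mul_smul, ofNat_smul_eq_nsmul ℝ 2]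

lemma inner_reflection (v x : E) : inner ℝ ((ℝ ∙ v)ᗮ.reflection x) v = -inner ℝ x v := by
  have h := (ℝ ∙ v)ᗮ.reflection.inner_map_map x v
  rw [Submodule.reflection_orthogonalComplement_singleton_eq_neg, inner_neg_right] at h
  linarith

/-- Intermediate value theorem: changing sides forces a visit to the hyperplane. So its first
hitting time is the exit time from an open set. -/
lemma forall_inner_ne_zero_iff {v : E} {w : ℝ≥0 → E} (hw : Continuous w)
    (h0 : 0 < inner ℝ (w 0) v) (t : ℝ≥0) :
    (∀ s ≤ t, w s ∈ {z : E | inner ℝ z v ≠ 0}) ↔ ∀ s ≤ t, 0 < inner ℝ (w s) v := by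
  refine ⟨fun h s hs => ?_, fun h s hs => (h s hs).ne'⟩
  by_contra hn
  have hcont : Continuous fun s => (inner ℝ (w s) v : ℝ) := hw.inner continuous_const
  obtain ⟨r, hr, hr0⟩ := intermediate_value_Icc' (zero_le (a := s)) hcont.continuousOn
    ⟨not_lt.1 hn, h0.le⟩
  exact h r (hr.2.trans hs) hr0

/-- The past of a Wiener process up to a fixed time, jointly with its later increments, has the
same law when the increments are transformed by a linear isometry. -/
lemma IsWienerProcess.map_isometry_increments [IsProbabilityMeasure P] {W : ℝ≥0 → S → E}
    (hW : IsWienerProcess W P) (hm : ∀ t, Measurable (W t)) (h0 : ∀ ω, W 0 ω = 0)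
    (L : E ≃ₗᵢ[ℝ] E) (x : E) (s : ℝ≥0) :
    P.map (fun ω => (stopPath s (fun t => x + W t ω),
        fun t => L (W t ω) - L (W (min t s) ω))) =
      P.map (fun ω => (stopPath s (fun t => x + W t ω),
        fun t => (x + W t ω) - (x + W (min t s) ω))) := by
  have hadd : Measurable fun (w : ℝ≥0 → E) t => x + w t :=
    measurable_pi_lambda _ fun t => measurable_const.add (measurable_pi_apply t)
  have hL : Measurable fun (w : ℝ≥0 → E) t => L (w t) :=
    measurable_pi_lambda _ fun t => L.continuous.measurable.comp (measurable_pi_apply t)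
  have hinc : Measurable fun (w : ℝ≥0 → E) t => w t - w (min t s) :=
    measurable_pi_lambda _ fun t => (measurable_pi_apply t).sub (measurable_pi_apply _)
  have hWp : Measurable fun ω => (W · ω) := measurable_pi_lambda _ hm
  have hLW : Measurable fun ω t => L (W t ω) := hL.comp hWp
  have hind := indepFun_stopPath_increments hm h0 hW.indep s
  have hf : Measurable ((fun (w : ℝ≥0 → E) t => x + w t) ∘ fun ω => stopPath s (W · ω)) :=
    hadd.comp ((measurable_stopPath s).comp hWp)
  have hg : Measurable fun ω t => W t ω - W (min t s) ω := hinc.comp hWp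
  have h1 := (indepFun_iff_map_prod_eq_prod_map_map hf.aemeasurable
    (hL.comp hg).aemeasurable).1 (hind.comp hadd hL)
  have h2 := (indepFun_iff_map_prod_eq_prod_map_map hf.aemeasurable
    (measurable_id.comp hg).aemeasurable).1 (hind.comp hadd measurable_id)
  have h3 : P.map ((fun (w : ℝ≥0 → E) t => L (w t)) ∘ fun ω t => W t ω - W (min t s) ω) =
      P.map (id ∘ fun ω t => W t ω - W (min t s) ω) := by
    have h4 := congrArg (fun μ => μ.map fun (w : ℝ≥0 → E) t => w t - w (min t s))
      (hW.map_isometry hm h0 L)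
    simp only [Measure.map_map hinc hLW, Measure.map_map hinc hWp] at h4
    refine Eq.trans ?_ h4
    congr 1
    ext1 ω
    simp
  rw [h3, ← h2] at h1
  refine Eq.trans ?_ (h1.trans ?_)
  · congr 1
    ext1 ω
    simp only [Function.comp_def, map_sub]
    rfl
  · congr 1
    ext1 ω
    simp only [Function.comp_def, id, add_sub_add_left_eq_sub]
    rfl

/-- Killed distributions of a Wiener process are carried over by a linear isometry that preserves
the domain. -/
lemma IsWienerProcess.measure_stay_isometry [IsProbabilityMeasure P] {W : ℝ≥0 → S → E}
    (hW : IsWienerProcess W P) (hm : ∀ t, Measurable (W t)) (hc : ∀ ω, Continuous (W · ω))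
    (h0 : ∀ ω, W 0 ω = 0) (L : E ≃ₗᵢ[ℝ] E) {D : Set E} (hD : IsOpen D)
    (hLD : ∀ z, L z ∈ D ↔ z ∈ D) (x : E) (t : ℝ≥0) {A : Set E} (hA : MeasurableSet A) :
    P {ω | (∀ s ≤ t, L x + W s ω ∈ D) ∧ L x + W t ω ∈ A} =
      P {ω | (∀ s ≤ t, x + W s ω ∈ D) ∧ L (x + W t ω) ∈ A} := by
  have hLm : ∀ s, Measurable fun ω => L (W s ω) := fun s => L.continuous.measurable.comp (hm s)
  have hadd : Measurable fun (w : ℝ≥0 → E) t => L x + w t :=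
    measurable_pi_lambda _ fun t => measurable_const.add (measurable_pi_apply t)
  have hlaw := congrArg (fun μ => μ.map fun (w : ℝ≥0 → E) t => L x + w t)
    (hW.map_isometry hm h0 L)
  simp only [Measure.map_map hadd (measurable_pi_lambda _ hLm),
    Measure.map_map hadd (measurable_pi_lambda (fun ω => (W · ω)) hm)] at hlaw
  have h := measure_stay_eq_of_map_eq (V := fun s ω => L x + W s ω)
    (U := fun s ω => L x + L (W s ω)) (fun s => (hm s).const_add _) (fun s => (hLm s).const_add _)
    (fun ω => continuous_const.add (hc ω))
    (fun ω => continuous_const.add (L.continuous.comp (hc ω))) hlaw.symm hD hA t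
  simpa only [← map_add, hLD] using h

/-- **Reflection principle** for a domain that is symmetric in a hyperplane. -/
lemma IsWienerProcess.measure_stay_eq_add [IsProbabilityMeasure P] {W : ℝ≥0 → S → E}
    (hW : IsWienerProcess W P) (hm : ∀ t, Measurable (W t)) (hc : ∀ ω, Continuous (W · ω))
    (h0 : ∀ ω, W 0 ω = 0) {v : E} {Ω : Set E} (hΩ : IsOpen Ω)
    (hsymm : ∀ z, (ℝ ∙ v)ᗮ.reflection z ∈ Ω ↔ z ∈ Ω) {x : E} (hx : 0 < inner ℝ x v) (t : ℝ≥0)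
    {A : Set E} (hA : MeasurableSet A) (hAΩ : A ⊆ positivePart v Ω) :
    P {ω | (∀ s ≤ t, x + W s ω ∈ Ω) ∧ x + W t ω ∈ A} =
      P {ω | (∀ s ≤ t, x + W s ω ∈ positivePart v Ω) ∧ x + W t ω ∈ A} +
      P {ω | (∀ s ≤ t, x + W s ω ∈ Ω) ∧ (ℝ ∙ v)ᗮ.reflection (x + W t ω) ∈ A} := by
  set L := (ℝ ∙ v)ᗮ.reflection with hLdef
  set H : Set E := {z | inner ℝ z v ≠ 0} with hHdef
  have hH : IsOpen H := isOpen_ne_fun (continuous_id.inner continuous_const) continuous_const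
  have hLm : Measurable L := L.continuous.measurable
  let V : ℝ≥0 → S → E := fun s ω => x + W s ω
  let X : ℝ≥0 → S → E := fun s ω => L (W s ω)
  have hV : ∀ s, Measurable (V s) := fun s => (hm s).const_add x
  have hX : ∀ s, Measurable (X s) := fun s => hLm.comp (hm s)
  have hVc : ∀ ω, Continuous (V · ω) := fun ω => continuous_const.add (hc ω)
  have hXc : ∀ ω, Continuous (X · ω) := fun ω => L.continuous.comp (hc ω)
  have hV0 : ∀ ω, 0 < inner ℝ (V 0 ω) v := fun ω => by simpa [V, h0] using hx
  have hVstop := exitBefore_le_iff_stopPath_mem hVc hH t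
  have hlaw := map_splice_eq hV hX hVc hXc (hW.map_isometry_increments hm h0 L x)
    (T := fun ω => exitBefore H t (V · ω)) hVstop
  have hτ : Measurable fun ω => exitBefore H t (V · ω) :=
    measurable_of_le_iff_stopPath_mem hV hVstop
  have hWu : Measurable (Function.uncurry W) :=
    measurable_uncurry_of_continuous_of_measurable hc hm
  let U : ℝ≥0 → S → E := fun s ω => splice (exitBefore H t (V · ω)) (V · ω) (X · ω) s
  have hU : ∀ s, Measurable (U s) := by
    intro s
    have hmin : Measurable fun ω => W (min s (exitBefore H t (V · ω))) ω :=
      hWu.comp ((measurable_const.min hτ).prodMk measurable_id)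
    exact (hmin.const_add x).add ((hX s).sub (hLm.comp hmin))
  have hUc : ∀ ω, Continuous (U · ω) := fun ω => continuous_splice _ (hVc ω) (hXc ω)
  -- `U` is the path reflected after its first visit to the hyperplane. It has the law of `V`, so
  -- the last term of the claim may be computed with `U`.
  have hrefl := measure_stay_eq_of_map_eq hU hV hUc hVc hlaw hΩ (hLm hA) t
  have hstayH : MeasurableSet {ω | ∀ s ≤ t, V s ω ∈ H} := measurableSet_stay hV hVc hH t
  rw [← measure_inter_add_sdiff (μ := P) {ω | (∀ s ≤ t, x + W s ω ∈ Ω) ∧ x + W t ω ∈ A} hstayH]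
  congr 1
  · congr 1
    ext ω
    have hiff := forall_inner_ne_zero_iff (hVc ω) (hV0 ω) t
    constructor
    · rintro ⟨⟨h1, h2⟩, h3⟩
      exact ⟨fun s hs => ⟨h1 s hs, hiff.1 h3 s hs⟩, h2⟩
    · rintro ⟨h1, h2⟩
      exact ⟨⟨fun s hs => (h1 s hs).1, h2⟩, hiff.2 fun s hs => (h1 s hs).2⟩
  · refine Eq.trans ?_ hrefl
    congr 1
    ext ω
    change (((∀ s ≤ t, V s ω ∈ Ω) ∧ V t ω ∈ A) ∧ ¬ ∀ s ≤ t, V s ω ∈ H) ↔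
      (∀ s ≤ t, U s ω ∈ Ω) ∧ L (U t ω) ∈ A
    by_cases hst : ∀ s ≤ t, V s ω ∈ H
    · refine iff_of_false (fun h => h.2 hst) fun h => ?_
      have hUt : U t ω = V t ω :=
        splice_of_le _ _ (exitBefore_eq_of_forall_mem hst).ge
      have h1 := (hAΩ h.2).2
      rw [inner_reflection, hUt] at h1
      have h2 := (forall_inner_ne_zero_iff (hVc ω) (hV0 ω) t).1 hst t le_rfl
      linarith
    · have hout := apply_exitBefore_notMem hH (hVc ω) hst
      set T := exitBefore H t (V · ω) with hT
      -- The hitting point lies on the mirror and is fixed, so reflecting the increments after `T`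
      -- reflects the path itself.
      have hfix : L (V T ω) = V T ω := by
        rw [hLdef, Submodule.reflection_eq_self_iff, Submodule.mem_orthogonal_singleton_iff_inner_left]
        simpa [hHdef] using hout
      have hUle : ∀ s ≤ T, U s ω = V s ω := fun s hs => splice_of_le _ _ hs
      have hUge : ∀ s, T ≤ s → U s ω = L (V s ω) := by
        intro s hs
        have : U s ω = V T ω + (L (W s ω) - L (W T ω)) := splice_of_ge _ _ hs
        rw [this]
        nth_rewrite 1 [← hfix]
        simp [V]
      have hmem : ∀ s, U s ω ∈ Ω ↔ V s ω ∈ Ω := by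
        intro s
        rcases le_total s T with h | h
        · rw [hUle s h]
        · rw [hUge s h, hsymm]
      have hLL : L (L (V t ω)) = V t ω := Submodule.reflection_reflection _ _
      simp only [hst, not_false_eq_true, and_true, hmem, hUge t (exitBefore_le _ _ _), hLL]

end Reflection

/-! ### From killed distributions to densities -/

section ReflectedDensity

variable {d : ℕ} {S : Type*} [MeasurableSpace S] {P : Measure S}

local notation "E" => EuclideanSpace ℝ (Fin d)

lemma isOpen_positivePart {v : E} {Ω : Set E} (hΩ : IsOpen Ω) : IsOpen (positivePart v Ω) := by
  have h : IsOpen {x : E | 0 < inner ℝ x v} :=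
    isOpen_lt continuous_const (continuous_id.inner continuous_const)
  exact hΩ.inter h

lemma reflection_mem_iff {v : E} {Ω : Set E} (hsymm : hyperplaneReflection v '' Ω = Ω) (z : E) :
    (ℝ ∙ v)ᗮ.reflection z ∈ Ω ↔ z ∈ Ω := by
  have h : ∀ z ∈ Ω, (ℝ ∙ v)ᗮ.reflection z ∈ Ω := fun z hz => by
    rw [← hyperplaneReflection_eq, ← hsymm]
    exact Set.mem_image_of_mem _ hz
  refine ⟨fun hz => ?_, h z⟩
  simpa using h _ hz

/-- The reflection principle for the distributions of the killed processes. -/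
lemma IsWienerProcess.killed_eq_add [IsProbabilityMeasure P] {W : ℝ≥0 → S → E}
    (hW : IsWienerProcess W P) {v : E} {Ω : Set E} (hΩ : IsOpen Ω)
    (hsymm : hyperplaneReflection v '' Ω = Ω) {x : E} (hx : x ∈ positivePart v Ω) (t : ℝ≥0)
    {A : Set E} (hA : MeasurableSet A) (hAΩ : A ⊆ positivePart v Ω) :
    P.real {ω | (t : WithTop ℝ≥0) < exitTime W Ω x ω ∧ x + W t ω ∈ A} =
      P.real {ω | (t : WithTop ℝ≥0) < exitTime W (positivePart v Ω) x ω ∧ x + W t ω ∈ A} +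
      P.real {ω | (t : WithTop ℝ≥0) < exitTime W Ω (hyperplaneReflection v x) ω ∧
        hyperplaneReflection v x + W t ω ∈ A} := by
  obtain ⟨W', hm, hc, h0, hae⟩ := hW.exists_regular
  have hW' := hW.congr hae
  have hrefl := reflection_mem_iff hsymm
  rw [Measure.real, Measure.real, Measure.real,
    ← ENNReal.toReal_add (measure_ne_top _ _) (measure_ne_top _ _),
    measure_killed_eq hc hae hΩ, measure_killed_eq hc hae hΩ,
    measure_killed_eq hc hae (isOpen_positivePart hΩ), hyperplaneReflection_eq,
    hW'.measure_stay_isometry hm hc h0 _ hΩ hrefl x t hA,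
    hW'.measure_stay_eq_add hm hc h0 hΩ hrefl hx.2 t hA hAΩ]

/-- By `killed_eq_add` both sides have the same integral over every measurable subset of the
positive part, and integrable functions are determined almost everywhere by such integrals. -/
lemma IsKilledTransitionDensity.ae_eq_sub [IsProbabilityMeasure P] {W : ℝ≥0 → S → E}
    (hW : IsWienerProcess W P) {v : E} {Ω : Set E} (hΩ : IsOpen Ω)
    (hsymm : hyperplaneReflection v '' Ω = Ω) {g gPlus : ℝ≥0 → E → E → ℝ}
    (hg : IsKilledTransitionDensity W P Ω g)
    (hgPlus : IsKilledTransitionDensity W P (positivePart v Ω) gPlus) {t : ℝ≥0} (ht : 0 < t)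
    {x : E} (hx : x ∈ positivePart v Ω) :
    ∀ᵐ y ∂(volume.restrict (positivePart v Ω)),
      gPlus t x y = g t x y - g t (hyperplaneReflection v x) y := by
  have hsub : positivePart v Ω ⊆ Ω := fun y hy => hy.1
  have hσx : hyperplaneReflection v x ∈ Ω := hsymm ▸ Set.mem_image_of_mem _ hx.1
  have hmeas : MeasurableSet (positivePart v Ω) := (isOpen_positivePart hΩ).measurableSet
  have h1 := hgPlus.integrable t ht x hx
  have h2 := (hg.integrable t ht x hx.1).mono_set hsub
  have h3 := (hg.integrable t ht _ hσx).mono_set hsub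
  refine Integrable.ae_eq_of_forall_setIntegral_eq _ _ h1 (h2.sub h3) fun B hB _ => ?_
  rw [Measure.restrict_restrict hB]
  have hBm : MeasurableSet (B ∩ positivePart v Ω) := hB.inter hmeas
  have hBsub : B ∩ positivePart v Ω ⊆ positivePart v Ω := Set.inter_subset_right
  have h := hW.killed_eq_add hΩ hsymm hx t hBm hBsub
  rw [hg.density t ht x hx.1 _ hBm (hBsub.trans hsub), hgPlus.density t ht x hx _ hBm hBsub,
    hg.density t ht _ hσx _ hBm (hBsub.trans hsub)] at h
  rw [integral_sub (h2.mono_set hBsub) (h3.mono_set hBsub)]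
  linarith

end ReflectedDensity

end

theorem mainTheorem6 {d : ℕ} {S : Type*} [MeasurableSpace S] (P : Measure S)
    [IsProbabilityMeasure P] (W : ℝ≥0 → S → EuclideanSpace ℝ (Fin d)) (hW : IsWienerProcess W P)
    (v : EuclideanSpace ℝ (Fin d)) (hv : v ≠ 0)
    (Ω : Set (EuclideanSpace ℝ (Fin d))) (hne : Ω.Nonempty) (hopen : IsOpen Ω)
    (hsymm : hyperplaneReflection v '' Ω = Ω) :
    -- both killed processes have transition densities that are continuous in the last variable
    (∃ g, IsContinuousKilledTransitionDensity W P Ω g) ∧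
    (∃ g, IsContinuousKilledTransitionDensity W P (positivePart v Ω) g) ∧
    -- the reflection identity holds everywhere for these densities
    (∀ g gPlus, IsContinuousKilledTransitionDensity W P Ω g →
      IsContinuousKilledTransitionDensity W P (positivePart v Ω) gPlus →
      ∀ t : ℝ≥0, 0 < t → ∀ x ∈ positivePart v Ω, ∀ y ∈ positivePart v Ω,
        gPlus t x y = g t x y - g t (hyperplaneReflection v x) y) ∧
    -- and almost everywhere in the last variable for arbitrary versions of the densities
    (∀ g gPlus, IsKilledTransitionDensity W P Ω g →
      IsKilledTransitionDensity W P (positivePart v Ω) gPlus →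
      ∀ t : ℝ≥0, 0 < t → ∀ x ∈ positivePart v Ω,
        ∀ᵐ y ∂(volume.restrict (positivePart v Ω)),
          gPlus t x y = g t x y - g t (hyperplaneReflection v x) y) := by
  refine ⟨hW.exists_isContinuousKilledTransitionDensity hopen,
    hW.exists_isContinuousKilledTransitionDensity (isOpen_positivePart hopen), ?_,
    fun g gPlus hg hgPlus t ht x hx => hg.ae_eq_sub hW hopen hsymm hgPlus ht hx⟩
  intro g gPlus hg hgPlus t ht x hx y hy
  have hsub : positivePart v Ω ⊆ Ω := fun z hz => hz.1
  have hσx : hyperplaneReflection v x ∈ Ω := hsymm ▸ Set.mem_image_of_mem _ hx.1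
  have hae := hg.toIsKilledTransitionDensity.ae_eq_sub hW hopen hsymm
    hgPlus.toIsKilledTransitionDensity ht hx
  -- Nonempty open sets have positive Lebesgue measure, so continuous functions that agree almost
  -- everywhere on an open set agree on all of it.
  exact Measure.eqOn_open_of_ae_eq hae (isOpen_positivePart hopen) (hgPlus.continuousOn t ht x hx)
    (((hg.continuousOn t ht x hx.1).mono hsub).sub ((hg.continuousOn t ht _ hσx).mono hsub)) hy
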